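/- **Setting.** A real-time transducer $\mathcal T=(Q,A,B^*,E,I,T)$ has finite sets of states $Q$ and of transitions $E$, a finite output alphabet $B$, sets $I,T\subseteq Q$ of initial and final states, and each transition $e: p\xrightarrow{a|x}q$ reads one letter $a\in A$ and outputs one word $x\in B^*$ (distinct transitions may carry the same data). A computation is successful if it goes from $I$ to $T$. A state is useful if it lies on a successful computation; $\mathcal T$ is trim if all its states are useful. $\mathcal T$ is $k$-valued if every input word has at most $k$ images. The underlying input automaton is obtained by forgetting the outputs; $\mathcal T$ is input-$k$-ambiguous if every input word labels at most $k$ successful computations, and unambiguous if this holds with $k=1$. An ordering $\prec$ of an automaton or transducer is a strict partial order on the transitions in which two distinct transitions are comparable iff they have the same origin and the same input letter, together with a strict total order, also written $\prec$, on the initial states. Let $n=|Q|$, $h=|B|$. *The transducer $\mathcal V_N$.* Fix an ordering $\prec$ of $\mathcal T$. In the free group on $B$ put $\Delta_N=\{y,\,y^{-1} : y\in B^*,\ |y|\le N\}$. The states of $\mathcal V_N$ are the pairs $(p,v)$, $p\in Q$, $v\in\mathfrak P(\Delta_N)^Q$. The initial ones are the $(p,v)$ with $p\in I$, $v_r=\{1\}$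 if $r\in I$, $r\prec p$, and $v_r=\emptyset$ otherwise. Each transition $e:p\xrightarrow{a|x}q$ of $\mathcal T$ and each state $(p,v)$ give a transition $(p,v)\xrightarrow{a|x}(q,v')$ with $$v'_r=\Delta_N\cap\Big(\{x^{-1}gy : f: s\xrightarrow{a|y}r \text{ in } E,\ g\in v_s\}\cup\{x^{-1}y : f: p\xrightarrow{a|y}r \text{ in } E,\ f\prec e\}\Big).$$ A state $(p,v)$ is final iff $p\in T$ and $1\notin v_t$ for all $t\in T$. *The transducers $\mathcal W^{(i)}$.* Let $L$ bound the lengths of the outputs of the transitions of $\mathcal T$, put $N=Ln^{k+1}$, let $\mathcal X$ be the trim part of $\mathcal V_N$ with state set $X$, and fix any ordering $\prec$ of $\mathcal X$. Let $\mathbb N_k=\{0,\dots,k-1,\omega\}$ be the quotient of the semiring $\mathbb N$ by $k=k+1$. For $0\le i<k$ the states of $\mathcal W^{(i)}$ are the pairs $(P,V)$, $P\in X$, $V\in\mathbb N_k^X$. The initial ones are the $(P,V)$ with $P$ initial in $\mathcal X$, $V_R=1$ if $R$ is initial and $R\prec P$, and $V_R=0$ otherwise. Each transition $e:P\xrightarrow{a|x}S$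 of $\mathcal X$ and each $(P,V)$ give a transition $(P,V)\xrightarrow{a|x}(S,V')$ with $$V'_R=\sum_{Y\in X}V_Y\cdot\#\{f: Y\to R \text{ reading } a\}+\#\{f: P\to R \text{ reading } a : f\prec e\}\quad\text{in }\mathbb N_k.$$ A state $(P,V)$ is final iff $P$ is final in $\mathcal X$ and $\sum_{R\text{ final}}V_R=i$ in $\mathbb N_k$. **Statement.** There is an absolute constant $C$ such that the following holds for every trim $k$-valued real-time transducer $\mathcal T$ with $n$ states and $h\ge1$ output letters, and for every ordering of $\mathcal T$. 1. For every $N\ge 1$, the transducer $\mathcal V_N$ has at most $2^{2hNk^2n}$ useful states, except possibly when $h=N=k=1$ and $n\ge5$. 2. Let $L\ge1$ be an upper bound of the lengths of the outputs of the transitions of $\mathcal T$. For $N=Ln^{k+1}$ the transducer $\mathcal V_N$ is input-$k$-ambiguous. For every ordering of its trim part, the transducers $\mathcal W^{(0)},\dots,\mathcal W^{(k-1)}$ are unambiguous, the union of the relations that they realise is the relation realised by $\mathcal T$, and each $\mathcal W^{(i)}$ has at most $2^{C\,hLk^4n^{k+4}}$ useful states. -/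

import Mathlib

namespace RatRel

universe u v w x

/-- A classical automaton over the alphabet `A`, with state set `Q` and set of transitions `E`.
Distinct transitions may have the same origin, label and end. -/
structure Automaton (Q : Type u) (A : Type v) (E : Type x) where
  src : E → Q
  inp : E → A
  dst : E → Q
  init : Set Q
  final : Set Q

/-- A real-time transducer from `A` to `B`: every transition reads one letter and outputs one word.
The inherited automaton (obtained by forgetting the outputs) is the underlying input automaton. -/
structure Transducer (Q : Type u) (A : Type v) (B : Type w) (E : Type x)
    extends Automaton Q A E where
  out : E → List B

namespace Automaton

variable {Q : Type u} {A : Type v} {E : Type x}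

/-- `M.IsComp p c q`: the sequence of transitions `c` is a computation from `p` to `q`. -/
def IsComp (M : Automaton Q A E) : Q → List E → Q → Prop
  | p, [], q => p = q
  | p, e :: c, q => M.src e = p ∧ M.IsComp (M.dst e) c q

/-- The successful computations with input `u`. A computation is given by its first state and its
sequence of transitions (the first state matters for computations of length zero). -/
def succComps (M : Automaton Q A E) (u : List A) : Set (Q × List E) :=
  {c | c.1 ∈ M.init ∧ (∃ q ∈ M.final, M.IsComp c.1 c.2 q) ∧ c.2.map M.inp = u}

/-- Every word labels at most `k` successful computations. -/
def IsAmbiguousAtMost (M : Automaton Q A E) (k : ℕ) : Prop :=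
  ∀ u : List A, (M.succComps u).encard ≤ k

/-- Every word labels at most one successful computation. -/
def Unambiguous (M : Automaton Q A E) : Prop := M.IsAmbiguousAtMost 1

def Accessible (M : Automaton Q A E) (q : Q) : Prop := ∃ p ∈ M.init, ∃ c, M.IsComp p c q

def Coaccessible (M : Automaton Q A E) (q : Q) : Prop := ∃ t ∈ M.final, ∃ c, M.IsComp q c t

def Useful (M : Automaton Q A E) (q : Q) : Prop := M.Accessible q ∧ M.Coaccessible q

def IsTrim (M : Automaton Q A E) : Prop := ∀ q, M.Useful q

/-- The orderings from which computations are ordered lexicographically: a strict partial order on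
the transitions, two distinct transitions being comparable iff they have the same origin and the
same label, and a strict total order on the initial states (the ordering of the transitions that
would leave a hidden initial state). -/
structure LexOrder (M : Automaton Q A E) where
  lt : E → E → Prop
  lt_irrefl : ∀ e, ¬ lt e e
  lt_trans : ∀ e f g, lt e f → lt f g → lt e g
  lt_same : ∀ e f, lt e f → M.src e = M.src f ∧ M.inp e = M.inp f
  lt_total : ∀ e f, M.src e = M.src f → M.inp e = M.inp f → e ≠ f → lt e f ∨ lt f e
  ltInit : Q → Q → Prop
  ltInit_irrefl : ∀ p, ¬ ltInit p p
  ltInit_trans : ∀ p q r, ltInit p q → ltInit q r → ltInit p r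
  ltInit_mem : ∀ p q, ltInit p q → p ∈ M.init ∧ q ∈ M.init
  ltInit_total : ∀ p ∈ M.init, ∀ q ∈ M.init, p ≠ q → ltInit p q ∨ ltInit q p

end Automaton

/-- `ℕ_k`: the quotient of the semiring `ℕ` by `k = k + 1`. The class of `j < k` is `j`, and `k`
represents the absorbing class `ω` of all the integers `≥ k`. -/
abbrev Trunc (k : ℕ) : Type := Fin (k + 1)

/-- The canonical projection from `ℕ` onto `ℕ_k`. -/
def trunc (k m : ℕ) : Trunc k := ⟨min m k, Nat.lt_succ_of_le (min_le_right m k)⟩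

namespace Automaton

variable {Q : Type u} {A : Type v} {E : Type x}

/-- The entry `(p, r)` of the matrix of the letter `a`: the number of transitions from `p` to `r`
labelled by `a`. -/
noncomputable def mult (M : Automaton Q A E) (p : Q) (a : A) (r : Q) : ℕ :=
  Nat.card {f : E // M.src f = p ∧ M.inp f = a ∧ M.dst f = r}

/-- The number of transitions smaller than `e` that end in `r`. -/
noncomputable def smaller (M : Automaton Q A E) (o : M.LexOrder) (e : E) (r : Q) : ℕ :=
  Nat.card {f : E // o.lt f e ∧ M.dst f = r}

/-- The transitions of a covering with state set `Q × V` of `M` that projects on the first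
component: one for every state `(p, v)` and every transition of `M` of origin `p`. -/
abbrev CovTrans (M : Automaton Q A E) (V : Type w) : Type (max u w x) :=
  {t : (Q × V) × E // M.src t.2 = t.1.1}

open Classical in
/-- The subautomaton number `i` of the multi-skimming covering at layer `k` of the (finite)
automaton `M`. The states are the `(p, v)` with `v ∈ ℕ_k ^ Q`. A transition `e : p → q` labelled `a`
of `M` gives a transition `(p, v) → (q, v · aμ + eς)` labelled `a`, the operations being made in
`ℕ_k`; the final states are the `(t, v)`, `t` final, such that the sum of the `v r`, `r` final,
is `i`. -/
noncomputable def skim (M : Automaton Q A E) (o : M.LexOrder) (k i : ℕ) :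
    Automaton (Q × (Q → Trunc k)) A (M.CovTrans (Q → Trunc k)) where
  src t := t.1.1
  inp t := M.inp t.1.2
  dst t := (M.dst t.1.2, fun r =>
    trunc k ((∑ᶠ q : Q, (t.1.1.2 q : ℕ) * M.mult q (M.inp t.1.2) r) + M.smaller o t.1.2 r))
  init := {s | s.1 ∈ M.init ∧ s.2 = fun r => trunc k (if o.ltInit r s.1 then 1 else 0)}
  final := {s | s.1 ∈ M.final ∧
    trunc k (∑ᶠ r : Q, if r ∈ M.final then (s.2 r : ℕ) else 0) = trunc k i}

end Automaton

/-- The image of a word in the free group. -/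
def wordFG {B : Type w} (y : List B) : FreeGroup B := (y.map FreeGroup.of).prod

/-- The positive and the negative words of length at most `N`, in the free group. -/
def lagSet (B : Type w) (N : ℕ) : Set (FreeGroup B) :=
  {g | ∃ y : List B, y.length ≤ N ∧ (g = wordFG y ∨ g = (wordFG y)⁻¹)}

theorem lagSet_finite (B : Type w) [Finite B] (N : ℕ) : (lagSet B N).Finite := by
  have hfin : {y : List B | y.length ≤ N}.Finite := List.finite_length_le B N
  refine ((hfin.image wordFG).union (hfin.image fun y => (wordFG y)⁻¹)).subset ?_
  rintro g ⟨y, hy, rfl | rfl⟩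
  · exact Or.inl ⟨y, hy, rfl⟩
  · exact Or.inr ⟨y, hy, rfl⟩

instance (B : Type w) [Finite B] (N : ℕ) : Finite (lagSet B N) := lagSet_finite B N

namespace Transducer

variable {Q : Type u} {A : Type v} {B : Type w} {E : Type x}

/-- The output of a sequence of transitions. -/
def outWord (T : Transducer Q A B E) (c : List E) : List B := (c.map T.out).flatten

/-- The relation realised by the transducer. -/
def rel (T : Transducer Q A B E) : Set (List A × List B) :=
  {z | ∃ c ∈ T.succComps z.1, T.outWord c.2 = z.2}

/-- The image of every word has at most `k` elements. -/
def KValued (T : Transducer Q A B E) (k : ℕ) : Prop :=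
  ∀ y : List A, {z : List B | (y, z) ∈ T.rel}.encard ≤ k

/-- The trim part: the restriction to the useful states. -/
def trimPart (T : Transducer Q A B E) :
    Transducer {q : Q // T.Useful q} A B {e : E // T.Useful (T.src e) ∧ T.Useful (T.dst e)} where
  src e := ⟨T.src e.1, e.2.1⟩
  inp e := T.inp e.1
  dst e := ⟨T.dst e.1, e.2.2⟩
  init := {q | q.1 ∈ T.init}
  final := {q | q.1 ∈ T.final}
  out e := T.out e.1

/-- The vectors indexed by the states whose entries are sets of words of `lagSet B N`. -/
abbrev LagVec (Q : Type u) (B : Type w) (N : ℕ) : Type (max u w) := Q → Set (lagSet B N)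

/-- The end of the transition of the lag separation covering that leaves a state of second
component `v` and projects on `e`. The second component of this end is the part in `lagSet B N` of
`x⁻¹ · v · aμ + eς`, where `e` reads `a` and outputs `x`. -/
def lagStep (T : Transducer Q A B E) (o : T.LexOrder) (N : ℕ) (vec : LagVec Q B N) (e : E) :
    Q × LagVec Q B N :=
  (T.dst e, fun r => {g |
    (∃ f : E, T.inp f = T.inp e ∧ T.dst f = r ∧
      ∃ g' ∈ vec (T.src f), (g : FreeGroup B) = (wordFG (T.out e))⁻¹ * g' * wordFG (T.out f)) ∨
    (∃ f : E, o.lt f e ∧ T.dst f = r ∧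
      (g : FreeGroup B) = (wordFG (T.out e))⁻¹ * wordFG (T.out f))})

/-- The lag separation covering with bound `N`. -/
def lagCover (T : Transducer Q A B E) (o : T.LexOrder) (N : ℕ) :
    Transducer (Q × LagVec Q B N) A B (T.CovTrans (LagVec Q B N)) where
  src t := t.1.1
  inp t := T.inp t.1.2
  dst t := T.lagStep o N t.1.1.2 t.1.2
  init := {s | s.1 ∈ T.init ∧ s.2 = fun r => {g : lagSet B N | o.ltInit r s.1 ∧ (g : FreeGroup B) = 1}}
  final := {s | s.1 ∈ T.final}
  out t := T.out t.1.2

/-- The subtransducer of the lag separation covering obtained by removing the property of being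
final of the states `(p, v)` such that the empty word is in `v t` for some final state `t`. -/
def lagSelect (T : Transducer Q A B E) (o : T.LexOrder) (N : ℕ) :
    Transducer (Q × LagVec Q B N) A B (T.CovTrans (LagVec Q B N)) :=
  { T.lagCover o N with
    final := {s | s ∈ (T.lagCover o N).final ∧
      ∀ t ∈ T.final, ∀ g ∈ s.2 t, (g : FreeGroup B) ≠ 1} }

/-- The transducer obtained from the subautomaton number `i` of the multi-skimming covering at
layer `k` of the underlying input automaton of `T` by lifting the outputs of `T`. -/
noncomputable def skim (T : Transducer Q A B E) (o : T.LexOrder) (k i : ℕ) :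
    Transducer (Q × (Q → Trunc k)) A B (T.CovTrans (Q → Trunc k)) :=
  { T.toAutomaton.skim o k i with
    out := fun t => T.out t.1.2 }

/-- The trim part of the selected subtransducer, for `N = L n ^ (k + 1)`, where `n` is the number of
states. -/
noncomputable abbrev core (T : Transducer Q A B E) (o : T.LexOrder) (k L : ℕ) :=
  (T.lagSelect o (L * Nat.card Q ^ (k + 1))).trimPart

/-- The decomposition given by the ordering `o` of the transducer and the ordering `o'` of the trim
part of the selected subtransducer. -/
noncomputable abbrev piece (T : Transducer Q A B E) (o : T.LexOrder) (k L : ℕ)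
    (o' : (T.core o k L).LexOrder) (i : ℕ) :=
  (T.core o k L).skim o' k i

end Transducer

end RatRel

/-!
The theorem is proved by comparing the computations of a trim `k`-valued transducer `T` with `n`
states that have the same input.

*The lags.* Consider `k + 1` successful computations on the same input, run in parallel in a power
of `T`. Call two of them apart if their outputs differ, or if the lengths of their outputs differ at
some time by more than `L n ^ (k + 1)`. In the second case a loop of the power produces outputs of
different lengths in the two computations (`Apart.exists_loop`). Iterating this loop separates the
two outputs, and it preserves the other pairs that are apart provided that distinct outputs stay
distinct. The latter fails for at most one number of iterations for each pair
(`subsingleton_setOf_pump_eq`): in a numeration base, the values of the two words are affine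
functions of the same exponential. Hence, if all pairs were apart, some input would have `k + 1`
images (`exists_not_apart`). So two of the computations have the same output and a small lag at all
times.

*The lag separation covering.* Its vector at the end of a computation is the set of the lags of the
smaller computations whose lag has stayed bounded (`mem_lagVec`). The previous fact shows that
`k + 1` distinct computations on the same input cannot all be successful in the selected
subtransducer. Adding a common continuation, it also shows that at most `k` of them end in useful
states over a given state of `T`; hence the trim part has at most `k n` histories with a given
input.
The smallest successful computation for each pair in the relation is kept, so the relation is
unchanged (`rel_lagSelect`).

*The multi-skimming covering.* Its vector counts the smaller computations by their ends
(`card_belowEnd_cons`, `foldr_skimStep`), so that the successful computations of the piece `i` lie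
over those with exactly `i` smaller successful ones. There is at most one of these for each input,
and every successful computation has fewer than `k` smaller ones.

*The sizes.* Since `T` is trim, an entry of an accessible vector of the lag separation covering has
at most `k` elements, and `lagSet B N` has fewer than `2 ^ (h N + 1)` elements, where `h` is the
number of output letters. This suffices unless `h = N = k = 1`; in this case the entry `p` of the
vector of a useful state `(p, v)` is moreover empty, which settles `n ≤ 4`. A vector of the
multi-skimming covering is determined by the ends of at most `k n` histories of the trim part.
-/

namespace RatRel

universe u v w x y

/-! ### Iterating a factor in two words -/

/-- The value in base `b` of a word with a factor repeated `m` times, multiplied by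
`b ^ |x| - 1`, is an affine function of `(b ^ |x|) ^ m`. -/
theorem ofDigits_pump (b m : ℕ) (s x t : List ℕ) :
    (((b : ℤ) ^ x.length - 1) *
        (Nat.ofDigits b (s ++ (List.replicate m x).flatten ++ t) : ℕ) : ℤ) =
      (((b : ℤ) ^ x.length - 1) * Nat.ofDigits b s - b ^ s.length * Nat.ofDigits b x) +
        ((b : ℤ) ^ x.length) ^ m * (b ^ s.length *
          (Nat.ofDigits b x + ((b : ℤ) ^ x.length - 1) * Nat.ofDigits b t)) := by
  have key : ∀ m : ℕ, (((b : ℤ) ^ x.length - 1) *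
      (Nat.ofDigits b ((List.replicate m x).flatten) : ℕ) : ℤ) =
        Nat.ofDigits b x * (((b : ℤ) ^ x.length) ^ m - 1) := by
    intro m
    induction m with
    | zero => simp
    | succ m ih =>
      rw [List.replicate_succ, List.flatten_cons, Nat.ofDigits_append]
      push_cast
      push_cast at ih
      rw [mul_add, mul_left_comm, ih]
      ring
  have hm := key m
  have hlen : ((List.replicate m x).flatten).length = m * x.length := by simp
  rw [Nat.ofDigits_append, Nat.ofDigits_append, List.length_append, hlen]
  push_cast
  push_cast at hm
  rw [pow_add, pow_mul', mul_add, mul_add, mul_left_comm, hm]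
  ring

/-- Two words that differ become equal for at most one number of repetitions of a factor in each
of them. -/
theorem subsingleton_setOf_pump_eq {B : Type w} [Finite B] (s x t s' x' t' : List B)
    (h : s ++ x ++ t ≠ s' ++ x' ++ t') :
    {m : ℕ | s ++ (List.replicate m x).flatten ++ t =
      s' ++ (List.replicate m x').flatten ++ t'}.Subsingleton := by
  intro m hm m' hm'
  by_contra hne
  simp only [Set.mem_ofPred_eq] at hm hm'
  have hl := congrArg List.length hm
  have hl' := congrArg List.length hm'
  simp only [List.length_append, List.length_flatten, List.map_replicate, List.sum_replicate,
    smul_eq_mul] at hl hl'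
  have hx : x.length = x'.length := by
    have h1 : ((m : ℤ) - m') * ((x.length : ℤ) - x'.length) = 0 := by
      zify at hl hl'
      linear_combination hl - hl'
    rcases mul_eq_zero.1 h1 with h2 | h2 <;> omega
  have hst : s.length + t.length = s'.length + t'.length := by
    rw [hx] at hl
    omega
  rcases Nat.eq_zero_or_pos x.length with h0 | hpos
  · have e1 : x = [] := List.length_eq_zero_iff.1 h0
    have e2 : x' = [] := List.length_eq_zero_iff.1 (hx ▸ h0)
    subst e1 e2
    apply h
    simpa using hm
  obtain ⟨n, ⟨f⟩⟩ := Finite.exists_equiv_fin B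
  set φ : B → ℕ := fun z => (f z : ℕ) with hφ
  have hφi : Function.Injective φ := fun z z' hz => f.injective (Fin.ext hz)
  set b : ℕ := n + 2 with hb
  -- the value of each word, as an affine function of the power of the base
  have conv : ∀ m : ℕ, s ++ (List.replicate m x).flatten ++ t =
      s' ++ (List.replicate m x').flatten ++ t' →
      Nat.ofDigits b (s.map φ ++ (List.replicate m (x.map φ)).flatten ++ t.map φ) =
      Nat.ofDigits b (s'.map φ ++ (List.replicate m (x'.map φ)).flatten ++ t'.map φ) := by
    intro m hm
    have := congrArg (List.map φ) hm
    simp only [List.map_append, List.map_flatten, List.map_replicate] at this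
    rw [this]
  have F := ofDigits_pump b
  have e1 := F m (s.map φ) (x.map φ) (t.map φ)
  have e2 := F m (s'.map φ) (x'.map φ) (t'.map φ)
  have e3 := F m' (s.map φ) (x.map φ) (t.map φ)
  have e4 := F m' (s'.map φ) (x'.map φ) (t'.map φ)
  have e5 := F 1 (s.map φ) (x.map φ) (t.map φ)
  have e6 := F 1 (s'.map φ) (x'.map φ) (t'.map φ)
  rw [conv m hm] at e1
  rw [conv m' hm'] at e3
  simp only [List.length_map, ← hx] at e1 e2 e3 e4 e5 e6
  rw [e1] at e2
  rw [e3] at e4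
  set H : ℤ := (b : ℤ) ^ x.length with hH
  have hH1 : 1 < H := one_lt_pow₀ (by rw [hb]; push_cast; omega) (by omega)
  generalize (b : ℤ) ^ s.length * ((Nat.ofDigits b (x.map φ) : ℕ) + (H - 1) *
    (Nat.ofDigits b (t.map φ) : ℕ)) = R at *
  generalize (b : ℤ) ^ s'.length * ((Nat.ofDigits b (x'.map φ) : ℕ) + (H - 1) *
    (Nat.ofDigits b (t'.map φ) : ℕ)) = R' at *
  generalize (H - 1) * (Nat.ofDigits b (s.map φ) : ℕ) - (b : ℤ) ^ s.length *
    (Nat.ofDigits b (x.map φ) : ℕ) = P at *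
  generalize (H - 1) * (Nat.ofDigits b (s'.map φ) : ℕ) - (b : ℤ) ^ s'.length *
    (Nat.ofDigits b (x'.map φ) : ℕ) = P' at *
  have hR : (H ^ m - H ^ m') * (R - R') = 0 := by linear_combination e2 - e4
  have hRR : R = R' := by
    rcases mul_eq_zero.1 hR with h1 | h1
    · exact absurd (pow_right_injective₀ (by omega) (by omega) (sub_eq_zero.1 h1)) hne
    · exact sub_eq_zero.1 h1
  have hPP : P = P' := by rw [hRR] at e2; linear_combination e2
  rw [hRR, hPP, ← e6] at e5
  have e7 := mul_left_cancel₀ (by omega) e5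
  have e8 : Nat.ofDigits b ((s ++ x ++ t).map φ) = Nat.ofDigits b ((s' ++ x' ++ t').map φ) := by
    have := Int.ofNat_inj.1 e7
    simpa using this
  have e9 := Nat.ofDigits_inj_of_len_eq (b := b) (by omega) (by simp; omega)
    (by
      intro d hd
      obtain ⟨z, -, rfl⟩ := List.mem_map.1 hd
      have := (f z).2
      simp only [hφ]; omega)
    (by
      intro d hd
      obtain ⟨z, -, rfl⟩ := List.mem_map.1 hd
      have := (f z).2
      simp only [hφ]; omega) e8
  exact h (hφi.list_map e9)

/-! ### Computations and histories -/

namespace Automaton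

variable {Q : Type u} {A : Type v} {E : Type x} {V : Type y} {M : Automaton Q A E}

theorem isComp_append {p q : Q} {c d : List E} :
    M.IsComp p (c ++ d) q ↔ ∃ r, M.IsComp p c r ∧ M.IsComp r d q := by
  induction c generalizing p with
  | nil => simp [IsComp]
  | cons e c ih => simp [IsComp, ih, and_assoc]

theorem IsComp.end_unique {p q q' : Q} {c : List E} (h : M.IsComp p c q) (h' : M.IsComp p c q') :
    q = q' := by
  induction c generalizing p with
  | nil => exact h.symm.trans h'
  | cons e c ih => exact ih h.2 h'.2

/-- `M.Hist p c q`: the list `c`, whose head is the last transition, is a computation from the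
initial state `p` to `q`. The vectors of the coverings are updated at the end of a computation, so
that they are computed by recursion on histories. -/
def Hist (M : Automaton Q A E) (p : Q) (c : List E) (q : Q) : Prop :=
  p ∈ M.init ∧ M.IsComp p c.reverse q

theorem hist_nil {p q : Q} : M.Hist p [] q ↔ p ∈ M.init ∧ p = q := Iff.rfl

theorem hist_cons {p q : Q} {e : E} {c : List E} :
    M.Hist p (e :: c) q ↔ M.dst e = q ∧ M.Hist p c (M.src e) := by
  simp only [Hist, List.reverse_cons, isComp_append, IsComp]
  constructor
  · rintro ⟨hp, r, hr, rfl, rfl⟩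
    exact ⟨rfl, hp, hr⟩
  · rintro ⟨rfl, hp, hr⟩
    exact ⟨hp, _, hr, rfl, rfl⟩

theorem Hist.end_unique {p q q' : Q} {c : List E} (h : M.Hist p c q) (h' : M.Hist p c q') :
    q = q' := h.2.end_unique h'.2

theorem Hist.accessible {p q : Q} {c : List E} (h : M.Hist p c q) : M.Accessible q :=
  ⟨p, h.1, _, h.2⟩

theorem Accessible.exists_hist {q : Q} (h : M.Accessible q) : ∃ p c, M.Hist p c q := by
  obtain ⟨p, hp, c, hc⟩ := h
  exact ⟨p, c.reverse, hp, by rwa [List.reverse_reverse]⟩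

/-- The histories of the successful computations whose input is the mirror image of `u`. -/
def succHists (M : Automaton Q A E) (u : List A) : Set (Q × List E) :=
  {c | (∃ q ∈ M.final, M.Hist c.1 c.2 q) ∧ c.2.map M.inp = u}

theorem mem_succHists_iff {p : Q} {c : List E} {u : List A} :
    (p, c) ∈ M.succHists u ↔ (p, c.reverse) ∈ M.succComps u.reverse := by
  simp only [succHists, succComps, Hist, Set.mem_ofPred_eq, List.map_reverse, List.reverse_inj]
  tauto

theorem encard_succComps (u : List A) :
    (M.succComps u).encard = (M.succHists u.reverse).encard := by
  have hinj : Function.Injective (fun c : Q × List E => (c.1, c.2.reverse)) := by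
    rintro ⟨p, c⟩ ⟨q, d⟩ h
    simpa using h
  rw [← hinj.encard_image (M.succHists u.reverse)]
  congr 1
  ext ⟨p, c⟩
  constructor
  · intro h
    refine ⟨(p, c.reverse), ?_, by simp⟩
    rw [mem_succHists_iff]
    simpa using h
  · rintro ⟨⟨q, d⟩, h, h'⟩
    rw [mem_succHists_iff] at h
    obtain ⟨rfl, rfl⟩ := Prod.ext_iff.1 h'
    simpa using h

theorem isAmbiguousAtMost_iff {k : ℕ} :
    M.IsAmbiguousAtMost k ↔ ∀ u, (M.succHists u).encard ≤ k := by
  simp only [IsAmbiguousAtMost, encard_succComps]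
  exact ⟨fun h u => by simpa using h u.reverse, fun h u => h _⟩

/-! ### The lexicographic ordering of the computations -/

/-- The lexicographic ordering: `o.Below p q c d` means that the history `c` from `p` precedes the
history `d` from `q`. -/
def LexOrder.Below (o : M.LexOrder) (p q : Q) : List E → List E → Prop
  | [], [] => o.ltInit p q
  | f :: c, e :: d => (LexOrder.Below o p q c d ∧ M.inp f = M.inp e) ∨ (p = q ∧ c = d ∧ o.lt f e)
  | _, _ => False

namespace LexOrder

variable {o : M.LexOrder} {p q r : Q} {c d b : List E}

theorem Below.map_inp (h : o.Below p q c d) : c.map M.inp = d.map M.inp := by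
  induction c generalizing d with
  | nil =>
    cases d with
    | nil => rfl
    | cons => exact h.elim
  | cons f c ih =>
    cases d with
    | nil => exact h.elim
    | cons e d =>
      rcases h with ⟨h, h'⟩ | ⟨-, rfl, h⟩
      · simp [ih h, h']
      · simp [(o.lt_same _ _ h).2]

theorem below_irrefl (o : M.LexOrder) (p : Q) (c : List E) : ¬ o.Below p p c c := by
  induction c with
  | nil => exact o.ltInit_irrefl p
  | cons e c ih =>
    rintro (⟨h, -⟩ | ⟨-, -, h⟩)
    · exact ih h
    · exact o.lt_irrefl _ h

theorem Below.trans (h : o.Below p q c d) (h' : o.Below q r d b) : o.Below p r c b := by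
  induction c generalizing d b with
  | nil =>
    cases d with
    | cons => exact h.elim
    | nil =>
      cases b with
      | cons => exact h'.elim
      | nil => exact o.ltInit_trans _ _ _ h h'
  | cons f c ih =>
    cases d with
    | nil => exact h.elim
    | cons e d =>
      cases b with
      | nil => exact h'.elim
      | cons g b =>
        rcases h with ⟨h1, h2⟩ | ⟨rfl, rfl, h1⟩
        · rcases h' with ⟨h3, h4⟩ | ⟨rfl, rfl, h3⟩
          · exact Or.inl ⟨ih h1 h3, h2.trans h4⟩
          · exact Or.inl ⟨h1, h2.trans (o.lt_same _ _ h3).2⟩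
        · rcases h' with ⟨h3, h4⟩ | ⟨rfl, rfl, h3⟩
          · exact Or.inl ⟨h3, (o.lt_same _ _ h1).2.trans h4⟩
          · exact Or.inr ⟨rfl, rfl, o.lt_trans _ _ _ h1 h3⟩

theorem below_total (o : M.LexOrder) {p' q' : Q} (h : M.Hist p c p') (h' : M.Hist q d q')
    (hi : c.map M.inp = d.map M.inp) (hne : (p, c) ≠ (q, d)) :
    o.Below p q c d ∨ o.Below q p d c := by
  induction c generalizing d p' q' with
  | nil =>
    cases d with
    | nil => exact o.ltInit_total p h.1 q h'.1 (fun hh => hne (by rw [hh]))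
    | cons => simp at hi
  | cons f c ih =>
    cases d with
    | nil => simp at hi
    | cons e d =>
      rw [hist_cons] at h h'
      simp only [List.map_cons, List.cons.injEq] at hi
      by_cases hcd : (p, c) = (q, d)
      · obtain ⟨rfl, rfl⟩ := Prod.ext_iff.1 hcd
        have hs : M.src f = M.src e := h.2.end_unique h'.2
        rcases o.lt_total f e hs hi.1 (fun hh => hne (by rw [hh])) with h1 | h1
        · exact Or.inl (Or.inr ⟨rfl, rfl, h1⟩)
        · exact Or.inr (Or.inr ⟨rfl, rfl, h1⟩)
      · rcases ih h.2 h'.2 hi.2 hcd with h1 | h1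
        · exact Or.inl (Or.inl ⟨h1, hi.1⟩)
        · exact Or.inr (Or.inl ⟨h1, hi.1.symm⟩)

end LexOrder

/-! ### Coverings -/

/-- `N` is a covering of `M` whose states carry a second component that starts with `v₀ p` in the
initial state `p` and is updated by `step`. The final states of `N` are arbitrary. -/
structure IsCovering (M : Automaton Q A E) (N : Automaton (Q × V) A (M.CovTrans V))
    (step : E → V → V) (v₀ : Q → V) : Prop where
  src_eq : ∀ t, N.src t = t.1.1
  inp_eq : ∀ t, N.inp t = M.inp t.1.2
  dst_eq : ∀ t, N.dst t = (M.dst t.1.2, step t.1.2 t.1.1.2)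
  mem_init : ∀ s, s ∈ N.init ↔ s.1 ∈ M.init ∧ s.2 = v₀ s.1

/-- The sequence of transitions of `M` under a sequence of transitions of a covering. -/
def covProj (M : Automaton Q A E) (C : List (M.CovTrans V)) : List E := C.map fun t => t.1.2

namespace IsCovering

variable {N : Automaton (Q × V) A (M.CovTrans V)} {step : E → V → V} {v₀ : Q → V}

theorem map_inp (hN : M.IsCovering N step v₀) (C : List (M.CovTrans V)) :
    (M.covProj C).map M.inp = C.map N.inp := by
  simp [covProj, hN.inp_eq]

theorem hist (hN : M.IsCovering N step v₀) {s z : Q × V} {C : List (M.CovTrans V)}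
    (h : N.Hist s C z) :
    M.Hist s.1 (M.covProj C) z.1 ∧ s.2 = v₀ s.1 ∧ z.2 = (M.covProj C).foldr step (v₀ s.1) := by
  induction C generalizing z with
  | nil =>
    obtain ⟨h1, rfl⟩ := hist_nil.1 h
    rw [hN.mem_init] at h1
    exact ⟨hist_nil.2 ⟨h1.1, rfl⟩, h1.2, h1.2⟩
  | cons t C ih =>
    obtain ⟨rfl, h0⟩ := hist_cons.1 h
    obtain ⟨h1, h2, h3⟩ := ih h0
    rw [hN.src_eq] at h1 h3
    refine ⟨hist_cons.2 ⟨by rw [hN.dst_eq], ?_⟩, h2, ?_⟩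
    · rw [t.2]
      exact h1
    · rw [hN.dst_eq, h3]
      rfl

theorem lift (hN : M.IsCovering N step v₀) {p q : Q} {c : List E} (h : M.Hist p c q) :
    ∃ C, N.Hist (p, v₀ p) C (q, c.foldr step (v₀ p)) ∧ M.covProj C = c := by
  induction c generalizing q with
  | nil =>
    obtain ⟨h1, rfl⟩ := hist_nil.1 h
    exact ⟨[], hist_nil.2 ⟨(hN.mem_init _).2 ⟨h1, rfl⟩, rfl⟩, rfl⟩
  | cons e c ih =>
    obtain ⟨rfl, h0⟩ := hist_cons.1 h
    obtain ⟨C, h1, h2⟩ := ih h0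
    refine ⟨⟨((M.src e, c.foldr step (v₀ p)), e), rfl⟩ :: C, hist_cons.2 ⟨?_, ?_⟩, ?_⟩
    · rw [hN.dst_eq]
      rfl
    · rw [hN.src_eq]
      exact h1
    · rw [← h2]
      rfl

theorem injective (hN : M.IsCovering N step v₀) {s s' z z' : Q × V} {C C' : List (M.CovTrans V)}
    (h : N.Hist s C z) (h' : N.Hist s' C' z') (hs : s.1 = s'.1)
    (hC : M.covProj C = M.covProj C') : s = s' ∧ C = C' := by
  have hss : s = s' := Prod.ext hs (by rw [(hN.hist h).2.1, (hN.hist h').2.1, hs])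
  subst hss
  refine ⟨rfl, ?_⟩
  induction C generalizing C' z z' with
  | nil =>
    cases C' with
    | nil => rfl
    | cons => simp [covProj] at hC
  | cons t C ih =>
    cases C' with
    | nil => simp [covProj] at hC
    | cons t' C' =>
      rw [hist_cons] at h h'
      simp only [covProj, List.map_cons, List.cons.injEq] at hC
      have hCC := ih h.2 hC.2 h'.2
      subst hCC
      have ht := h.2.end_unique h'.2
      rw [hN.src_eq, hN.src_eq] at ht
      rw [Subtype.ext (Prod.ext ht hC.1)]

end IsCovering

/-! ### Powers of an automaton -/

/-- The automaton that runs a family of computations in parallel. -/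
def pow (M : Automaton Q A E) (I : Type y) : Automaton (I → Q) (I → A) (I → E) where
  src e i := M.src (e i)
  inp e i := M.inp (e i)
  dst e i := M.dst (e i)
  init := {p | ∀ i, p i ∈ M.init}
  final := {p | ∀ i, p i ∈ M.final}

theorem isComp_pow {I : Type y} {p q : I → Q} {c : List (I → E)} :
    (M.pow I).IsComp p c q ↔ ∀ i, M.IsComp (p i) (c.map (· i)) (q i) := by
  induction c generalizing p with
  | nil => exact funext_iff
  | cons e c ih =>
    simp only [IsComp, ih, List.map_cons, funext_iff, forall_and]
    rfl

/-- Lists of the same length are the components of a list of families. -/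
theorem exists_list_map_eq {I : Type y} {α : Type x} (n : ℕ) (c : I → List α)
    (h : ∀ i, (c i).length = n) : ∃ l : List (I → α), ∀ i, l.map (· i) = c i := by
  refine ⟨List.ofFn fun (t : Fin n) i => (c i)[t]'(by rw [h]; exact t.2), fun i => ?_⟩
  rw [List.map_ofFn]
  apply List.ext_getElem
  · simp [h]
  · intro m h1 h2
    simp

theorem isComp_replicate {p : Q} {c : List E} (h : M.IsComp p c p) (m : ℕ) :
    M.IsComp p (List.replicate m c).flatten p := by
  induction m with
  | zero => rfl
  | succ m ih =>
    rw [List.replicate_succ, List.flatten_cons]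
    exact isComp_append.2 ⟨p, h, ih⟩

end Automaton

/-! ### Two computations with equal outputs and small lags -/

theorem wordFG_append {B : Type w} (s t : List B) : wordFG (s ++ t) = wordFG s * wordFG t := by
  simp [wordFG]

theorem wordFG_nil {B : Type w} : wordFG ([] : List B) = 1 := rfl

theorem one_mem_lagSet (B : Type w) (N : ℕ) : (1 : FreeGroup B) ∈ lagSet B N :=
  ⟨[], Nat.zero_le _, Or.inl rfl⟩

/-- The lag of two prefixes of a word is bounded by the difference of their lengths. -/
theorem lag_mem_lagSet {B : Type w} {N : ℕ} {s t s' t' : List B} (h : s ++ t = s' ++ t')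
    (hN : |(s.length : ℤ) - s'.length| ≤ N) : (wordFG s)⁻¹ * wordFG s' ∈ lagSet B N := by
  rw [abs_le] at hN
  rcases List.append_eq_append_iff.1 h with ⟨a, rfl, -⟩ | ⟨a, rfl, -⟩
  · refine ⟨a, ?_, Or.inl (by rw [wordFG_append, inv_mul_cancel_left])⟩
    rw [List.length_append] at hN
    push_cast at hN
    omega
  · refine ⟨a, ?_, Or.inr (by rw [wordFG_append]; group)⟩
    rw [List.length_append] at hN
    push_cast at hN
    omega

namespace Transducer

variable {Q : Type u} {A : Type v} {B : Type w} {E : Type x} {I : Type y}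
  {T : Transducer Q A B E}

theorem outWord_append (c d : List E) : T.outWord (c ++ d) = T.outWord c ++ T.outWord d := by
  simp [outWord]

/-- The output of the component `i` of a computation of a power of `T`. -/
def outAt (T : Transducer Q A B E) (i : I) (c : List (I → E)) : List B := T.outWord (c.map (· i))

theorem outAt_append (i : I) (c d : List (I → E)) :
    T.outAt i (c ++ d) = T.outAt i c ++ T.outAt i d := by
  simp [outAt, outWord]

theorem outAt_replicate (i : I) (m : ℕ) (c : List (I → E)) :
    T.outAt i (List.replicate m c).flatten = (List.replicate m (T.outAt i c)).flatten := by
  induction m with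
  | zero => rfl
  | succ m ih => rw [List.replicate_succ, List.flatten_cons, outAt_append, ih]; rfl

/-- The difference of the lengths of the outputs of two components. -/
def lenDiff (T : Transducer Q A B E) (i j : I) (c : List (I → E)) : ℤ :=
  (T.outAt i c).length - (T.outAt j c).length

theorem lenDiff_append (i j : I) (c d : List (I → E)) :
    T.lenDiff i j (c ++ d) = T.lenDiff i j c + T.lenDiff i j d := by
  simp only [lenDiff, outAt_append, List.length_append]
  push_cast
  ring

theorem lenDiff_replicate (i j : I) (m : ℕ) (c : List (I → E)) :
    T.lenDiff i j (List.replicate m c).flatten = m * T.lenDiff i j c := by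
  simp only [lenDiff, outAt_replicate, List.length_flatten, List.map_replicate,
    List.sum_replicate, smul_eq_mul]
  push_cast
  ring

theorem lenDiff_swap (i j : I) (c : List (I → E)) : T.lenDiff i j c = - T.lenDiff j i c := by
  simp [lenDiff]

theorem lenDiff_singleton_le {L : ℕ} (hL : ∀ e, (T.out e).length ≤ L) (i j : I) (e : I → E) :
    T.lenDiff i j [e] ≤ L := by
  have := hL (e i)
  simp only [lenDiff, outAt, outWord, List.map_cons, List.map_nil, List.flatten_cons,
    List.flatten_nil, List.append_nil]
  omega

theorem lenDiff_take_succ_le {L : ℕ} (hL : ∀ e, (T.out e).length ≤ L) (i j : I)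
    (c : List (I → E)) (m : ℕ) :
    T.lenDiff i j (c.take (m + 1)) ≤ T.lenDiff i j (c.take m) + L := by
  rcases lt_or_ge m c.length with h | h
  · rw [List.take_succ_eq_append_getElem h, lenDiff_append]
    exact add_le_add_right (lenDiff_singleton_le hL i j _) _
  · rw [List.take_of_length_le h, List.take_of_length_le (by omega)]
    omega

theorem exists_loop_of_lt_lenDiff [Finite Q] [Finite I] {L : ℕ} (hL1 : 1 ≤ L)
    (hL : ∀ e, (T.out e).length ≤ L) {i j : I} {p t : I → Q} {c : List (I → E)}
    (hc : (T.toAutomaton.pow I).IsComp p c t) {n : ℕ}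
    (hn : (L * Nat.card (I → Q) : ℤ) < T.lenDiff i j (c.take n)) :
    ∃ c₁ c₂ c₃ r, c = c₁ ++ c₂ ++ c₃ ∧ (T.toAutomaton.pow I).IsComp p c₁ r ∧
      (T.toAutomaton.pow I).IsComp r c₂ r ∧ (T.toAutomaton.pow I).IsComp r c₃ t ∧
      T.lenDiff i j c₂ ≠ 0 := by
  set M := Nat.card (I → Q) with hM
  have hstate : ∀ m, ∃ r, (T.toAutomaton.pow I).IsComp p (c.take m) r ∧
      (T.toAutomaton.pow I).IsComp r (c.drop m) t := by
    intro m
    rw [← Automaton.isComp_append, List.take_append_drop]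
    exact hc
  choose r hr hr' using hstate
  -- the first time at which the difference of the lengths is at least `a * L`
  have hex : ∀ a : Fin (M + 1), ∃ m, ((a : ℕ) * L : ℤ) ≤ T.lenDiff i j (c.take m) := by
    intro a
    refine ⟨n, le_trans ?_ hn.le⟩
    rw [mul_comm]
    have : (a : ℕ) ≤ M := Nat.lt_succ_iff.1 a.2
    gcongr
  classical
  set τ : Fin (M + 1) → ℕ := fun a => Nat.find (hex a) with hτ
  have h1 : ∀ a : Fin (M + 1), ((a : ℕ) * L : ℤ) ≤ T.lenDiff i j (c.take (τ a)) :=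
    fun a => Nat.find_spec (hex a)
  have h2 : ∀ a : Fin (M + 1), T.lenDiff i j (c.take (τ a)) < ((a : ℕ) + 1) * L := by
    intro a
    rcases hm : τ a with _ | m
    · simp only [List.take_zero, lenDiff, outAt, outWord, List.map_nil, List.flatten_nil,
        List.length_nil]
      norm_num
      positivity
    · have h3 : ¬ ((a : ℕ) * L : ℤ) ≤ T.lenDiff i j (c.take m) :=
        Nat.find_min (hex a) (by simp only [hτ] at hm; omega)
      have h4 := lenDiff_take_succ_le hL i j c m
      rw [add_mul, one_mul]
      omega
  have : Fintype (I → Q) := Fintype.ofFinite _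
  obtain ⟨a, a', hne, haa⟩ := Fintype.exists_ne_map_eq_of_card_lt (fun a => r (τ a))
    (by rw [Fintype.card_fin, hM, Nat.card_eq_fintype_card]; omega)
  wlog hlt : a < a' generalizing a a'
  · exact this a' a hne.symm haa.symm (lt_of_le_of_ne (not_lt.1 hlt) hne.symm)
  have hlt' : (a : ℕ) + 1 ≤ (a' : ℕ) := hlt
  have h3 : T.lenDiff i j (c.take (τ a)) < T.lenDiff i j (c.take (τ a')) := by
    refine lt_of_lt_of_le (h2 a) (le_trans ?_ (h1 a'))
    have : ((a : ℕ) : ℤ) + 1 ≤ (a' : ℕ) := by exact_mod_cast hlt'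
    gcongr
  have hle : τ a ≤ τ a' := by
    refine Nat.find_min' (hex a) (le_trans ?_ (h1 a'))
    have : ((a : ℕ) : ℤ) ≤ (a' : ℕ) := by exact_mod_cast (by omega : (a : ℕ) ≤ a')
    gcongr
  have hsplit : c.take (τ a') = c.take (τ a) ++ (c.take (τ a')).drop (τ a) := by
    conv_lhs => rw [← List.take_append_drop (τ a) (c.take (τ a'))]
    rw [List.take_take, min_eq_left hle]
  refine ⟨c.take (τ a), (c.take (τ a')).drop (τ a), c.drop (τ a'), r (τ a), ?_, hr _, ?_, ?_, ?_⟩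
  · rw [← hsplit, List.take_append_drop]
  · have h4 := hr (τ a')
    rw [hsplit, Automaton.isComp_append] at h4
    obtain ⟨r', h5, h6⟩ := h4
    rw [← (hr (τ a)).end_unique h5] at h6
    rwa [← haa] at h6
  · rw [haa]
    exact hr' _
  · intro h0
    rw [hsplit, lenDiff_append, h0] at h3
    omega

/-- The components `i` and `j` have different outputs, or the lengths of their outputs differ by
more than `N` at some time. -/
def Apart (T : Transducer Q A B E) (N : ℕ) (i j : I) (c : List (I → E)) : Prop :=
  T.outAt i c ≠ T.outAt j c ∨ ∃ b, b <+: c ∧ (N : ℤ) < |T.lenDiff i j b|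

theorem Apart.exists_loop [Finite Q] [Finite I] {L : ℕ} (hL1 : 1 ≤ L)
    (hL : ∀ e, (T.out e).length ≤ L) {i j : I} {p t : I → Q} {c : List (I → E)}
    (hc : (T.toAutomaton.pow I).IsComp p c t) (h : T.Apart (L * Nat.card (I → Q)) i j c)
    (heq : T.outAt i c = T.outAt j c) :
    ∃ c₁ c₂ c₃ r, c = c₁ ++ c₂ ++ c₃ ∧ (T.toAutomaton.pow I).IsComp p c₁ r ∧
      (T.toAutomaton.pow I).IsComp r c₂ r ∧ (T.toAutomaton.pow I).IsComp r c₃ t ∧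
      T.lenDiff i j c₂ ≠ 0 := by
  rcases h with h | ⟨b, hb, h⟩
  · exact absurd heq h
  rw [List.prefix_iff_eq_take] at hb
  rw [hb] at h
  push_cast at h
  rcases lt_abs.1 h with h | h
  · exact exists_loop_of_lt_lenDiff hL1 hL hc h
  · rw [← lenDiff_swap] at h
    obtain ⟨c₁, c₂, c₃, r, h1, h2, h3, h4, h5⟩ := exists_loop_of_lt_lenDiff hL1 hL hc h
    exact ⟨c₁, c₂, c₃, r, h1, h2, h3, h4, fun h6 => h5 (by rw [lenDiff_swap, h6, neg_zero])⟩

theorem lenDiff_eq_zero {i j : I} {c : List (I → E)} (h : T.outAt i c = T.outAt j c) :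
    T.lenDiff i j c = 0 := by
  simp [lenDiff, h]

/-- Two components apart remain so when a factor on which the outputs of distinct components stay
distinct is repeated. -/
theorem Apart.pump {N : ℕ} {i j : I} {c₁ c₂ c₃ : List (I → E)} {m : ℕ} (hm : 2 ≤ m)
    (hdist : T.outAt i (c₁ ++ c₂ ++ c₃) ≠ T.outAt j (c₁ ++ c₂ ++ c₃) →
      T.outAt i (c₁ ++ (List.replicate m c₂).flatten ++ c₃) ≠
        T.outAt j (c₁ ++ (List.replicate m c₂).flatten ++ c₃))
    (h : T.Apart N i j (c₁ ++ c₂ ++ c₃)) :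
    T.Apart N i j (c₁ ++ (List.replicate m c₂).flatten ++ c₃) := by
  by_cases hne : T.outAt i (c₁ ++ c₂ ++ c₃) = T.outAt j (c₁ ++ c₂ ++ c₃)
  swap
  · exact Or.inl (hdist hne)
  by_cases h0 : T.lenDiff i j c₂ = 0
  swap
  · -- the lengths of the outputs are equal for one iteration only
    refine Or.inl fun h1 => h0 ?_
    have h2 := lenDiff_eq_zero hne
    have h3 := lenDiff_eq_zero h1
    simp only [lenDiff_append, lenDiff_replicate] at h2 h3
    have h4 : ((m : ℤ) - 1) * T.lenDiff i j c₂ = 0 := by linear_combination h3 - h2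
    rcases mul_eq_zero.1 h4 with h5 | h5
    · omega
    · exact h5
  rcases h with h | ⟨b, hb, h⟩
  · exact absurd hne h
  right
  obtain ⟨d, hd⟩ := hb
  rcases List.append_eq_append_iff.1 hd with ⟨a, h1, -⟩ | ⟨a, rfl, h1⟩
  · obtain ⟨m, rfl⟩ : ∃ m', m = m' + 1 := ⟨m - 1, by omega⟩
    refine ⟨b, ⟨a ++ (List.replicate m c₂).flatten ++ c₃, ?_⟩, h⟩
    rw [List.replicate_succ, List.flatten_cons, ← List.append_assoc c₁, h1]
    simp
  · refine ⟨c₁ ++ (List.replicate m c₂).flatten ++ a, ⟨d, by simp [h1]⟩, ?_⟩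
    simp only [lenDiff_append, lenDiff_replicate, h0] at h ⊢
    simpa using h

/-- In a family of `k + 1` computations of a `k`-valued transducer with the same input, two are not
apart: otherwise, iterating loops yields a family with `k + 1` distinct outputs. -/
theorem exists_not_apart [Finite Q] [Finite B] {k L : ℕ} (hk : T.KValued k) (hL1 : 1 ≤ L)
    (hL : ∀ e, (T.out e).length ≤ L) {p t : Fin (k + 1) → Q} {c : List (Fin (k + 1) → E)}
    (hp : ∀ i, p i ∈ T.init) (ht : ∀ i, t i ∈ T.final)
    (hc : (T.toAutomaton.pow (Fin (k + 1))).IsComp p c t)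
    (hin : ∀ e ∈ c, ∀ i j, T.inp (e i) = T.inp (e j)) :
    ∃ i j, i ≠ j ∧ ¬ T.Apart (L * Nat.card (Fin (k + 1) → Q)) i j c := by
  by_contra! hap
  induction hs : {z : Fin (k + 1) × Fin (k + 1) | z.1 ≠ z.2 ∧
    T.outAt z.1 c = T.outAt z.2 c}.ncard using Nat.strong_induction_on generalizing c with
  | _ s ih =>
  by_cases hinj : ∃ i j, i ≠ j ∧ T.outAt i c = T.outAt j c
  swap
  · push Not at hinj
    have hinj' : Function.Injective fun i => T.outAt i c := fun i j h => by
      by_contra hij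
      exact hinj i j hij h
    have hsub : Set.range (fun i => T.outAt i c) ⊆
        {z | ((c.map (· 0)).map T.inp, z) ∈ T.rel} := by
      rintro _ ⟨i, rfl⟩
      refine ⟨(p i, c.map (· i)), ⟨hp i, ⟨t i, ht i, Automaton.isComp_pow.1 hc i⟩, ?_⟩, rfl⟩
      rw [List.map_map, List.map_map]
      exact List.map_congr_left fun e he => hin e he i 0
    have h1 := (Set.encard_le_encard hsub).trans (hk _)
    rw [← Set.image_univ, hinj'.encard_image, Set.encard_univ, ENat.card_eq_coe_natCard,
      Nat.card_eq_fintype_card, Fintype.card_fin] at h1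
    exact absurd (by exact_mod_cast h1) (Nat.not_succ_le_self k)
  obtain ⟨i, j, hij, heq⟩ := hinj
  obtain ⟨c₁, c₂, c₃, r, rfl, h1, h2, h3, h4⟩ := (hap i j hij).exists_loop hL1 hL hc heq
  -- a number of iterations that identifies no two distinct outputs
  have hfin : (⋃ z ∈ {z : Fin (k + 1) × Fin (k + 1) | T.outAt z.1 (c₁ ++ c₂ ++ c₃) ≠
      T.outAt z.2 (c₁ ++ c₂ ++ c₃)}, {m : ℕ | T.outAt z.1 c₁ ++
        (List.replicate m (T.outAt z.1 c₂)).flatten ++ T.outAt z.1 c₃ = T.outAt z.2 c₁ ++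
        (List.replicate m (T.outAt z.2 c₂)).flatten ++ T.outAt z.2 c₃}).Finite := by
    refine Set.Finite.biUnion (Set.toFinite _) fun z hz => Set.Subsingleton.finite ?_
    apply subsingleton_setOf_pump_eq
    simp only [← outAt_append]
    exact hz
  obtain ⟨m, hm⟩ := (hfin.union (Set.finite_lt_nat 2)).exists_notMem
  rw [Set.mem_union, not_or] at hm
  obtain ⟨hm1, hm2⟩ := hm
  replace hm2 : 2 ≤ m := not_lt.1 hm2
  have hdist : ∀ a b, T.outAt a (c₁ ++ c₂ ++ c₃) ≠ T.outAt b (c₁ ++ c₂ ++ c₃) →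
      T.outAt a (c₁ ++ (List.replicate m c₂).flatten ++ c₃) ≠
        T.outAt b (c₁ ++ (List.replicate m c₂).flatten ++ c₃) := by
    intro a b hab h5
    apply hm1
    refine Set.mem_biUnion (show (a, b) ∈ _ from hab) ?_
    simp only [outAt_append, outAt_replicate] at h5
    exact h5
  refine ih _ ?_ (c := c₁ ++ (List.replicate m c₂).flatten ++ c₃) ?_ ?_ ?_ rfl
  · rw [← hs]
    refine Set.ncard_lt_ncard ⟨fun z hz => ⟨hz.1, ?_⟩, fun hsub => ?_⟩ (Set.toFinite _)
    · by_contra h5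
      exact hdist _ _ h5 hz.2
    · have h5 := (hsub (show (i, j) ∈ _ from ⟨hij, heq⟩)).2
      have h6 := lenDiff_eq_zero h5
      have h7 := lenDiff_eq_zero heq
      simp only [lenDiff_append, lenDiff_replicate] at h6 h7
      have h8 : ((m : ℤ) - 1) * T.lenDiff i j c₂ = 0 := by linear_combination h6 - h7
      rcases mul_eq_zero.1 h8 with h9 | h9
      · omega
      · exact h4 h9
  · exact Automaton.isComp_append.2 ⟨r, Automaton.isComp_append.2
      ⟨r, h1, Automaton.isComp_replicate h2 m⟩, h3⟩
  · intro e he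
    apply hin
    simp only [List.mem_append, List.mem_flatten, List.mem_replicate] at he ⊢
    rcases he with (he | ⟨_, ⟨-, rfl⟩, he⟩) | he
    · exact Or.inl (Or.inl he)
    · exact Or.inl (Or.inr he)
    · exact Or.inr he
  · intro a b hab
    exact (hap a b hab).pump hm2 (hdist a b)

/-- Among `k + 1` successful computations of a `k`-valued transducer with the same input, two have
the same output and a lag that remains bounded by `L n ^ (k + 1)`. -/
theorem exists_outWord_eq_and_lag_mem [Finite Q] [Finite B] {k L : ℕ} (hk : T.KValued k)
    (hL1 : 1 ≤ L) (hL : ∀ e, (T.out e).length ≤ L) {u : List A} {c : Fin (k + 1) → Q × List E}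
    (hc : ∀ i, c i ∈ T.succComps u) :
    ∃ i j, i ≠ j ∧ T.outWord (c i).2 = T.outWord (c j).2 ∧
      ∀ m, (wordFG (T.outWord ((c i).2.take m)))⁻¹ * wordFG (T.outWord ((c j).2.take m)) ∈
        lagSet B (L * Nat.card Q ^ (k + 1)) := by
  choose hp ht hin using hc
  choose t ht ht' using ht
  obtain ⟨l, hl⟩ := Automaton.exists_list_map_eq u.length (fun i => (c i).2) (fun i => by
    rw [← hin i, List.length_map])
  obtain ⟨i, j, hij, hap⟩ := exists_not_apart hk hL1 hL (p := fun i => (c i).1) (t := t) (c := l)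
    hp ht (Automaton.isComp_pow.2 fun i => by rw [hl i]; exact ht' i) (by
      intro e he i j
      have h1 : (l.map (· i)).map T.inp = (l.map (· j)).map T.inp := by
        rw [hl i, hl j, hin i, hin j]
      rw [List.map_map, List.map_map] at h1
      exact List.map_inj_left.1 h1 e he)
  rw [Apart, not_or, not_not] at hap
  obtain ⟨h1, h2⟩ := hap
  push Not at h2
  rw [Nat.card_fun, Nat.card_eq_fintype_card (α := Fin (k + 1)), Fintype.card_fin] at h2
  have h3 : T.outWord (c i).2 = T.outWord (c j).2 := by
    simpa only [outAt, hl] using h1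
  refine ⟨i, j, hij, h3, fun m => ?_⟩
  have h4 := h2 (l.take m) (List.take_prefix m l)
  simp only [lenDiff, outAt, List.map_take, hl] at h4
  refine lag_mem_lagSet (t := T.outWord ((c i).2.drop m)) (t' := T.outWord ((c j).2.drop m)) ?_ h4
  rw [← outWord_append, ← outWord_append, List.take_append_drop, List.take_append_drop, h3]

end Transducer

theorem wordFG_injective {B : Type w} : Function.Injective (wordFG : List B → FreeGroup B) := by
  classical
  have h1 : ∀ y : List B, wordFG y = FreeGroup.mk (y.map fun b => (b, true)) := by
    intro y
    induction y with
    | nil => rfl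
    | cons b y ih =>
      have h2 : wordFG (b :: y) = FreeGroup.of b * wordFG y := by simp [wordFG]
      rw [h2, ih, FreeGroup.of, FreeGroup.mul_mk]
      rfl
  have h2 : ∀ y : List B, (wordFG y).toWord = y.map fun b => (b, true) := by
    intro y
    rw [h1, FreeGroup.toWord_mk]
    apply FreeGroup.IsReduced.reduce_eq
    rw [FreeGroup.IsReduced, List.isChain_map]
    induction y with
    | nil => exact List.isChain_nil
    | cons b y ih => cases y <;> simp_all
  intro y z h
  have h3 := congrArg FreeGroup.toWord h
  rw [h2, h2] at h3
  exact List.map_injective_iff.2 (fun a b h => (Prod.ext_iff.1 h).1) h3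

theorem exists_injective_of_lt_encard {α : Type*} {s : Set α} {k : ℕ} (h : (k : ℕ∞) < s.encard) :
    ∃ f : Fin (k + 1) → α, Function.Injective f ∧ ∀ i, f i ∈ s := by
  obtain ⟨t, hts, ht⟩ := Set.exists_subset_encard_eq (Order.add_one_le_of_lt h)
  have hfin : t.Finite := Set.finite_of_encard_eq_coe (k := k + 1) (by rw [ht]; rfl)
  have : Finite t := hfin
  have hcard : Nat.card t = k + 1 := by
    rw [Nat.card_coe_set_eq, Set.ncard, ht]
    rfl
  refine ⟨fun i => ((Finite.equivFinOfCardEq hcard).symm i : α), ?_, fun i => hts (Subtype.prop _)⟩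
  exact Subtype.val_injective.comp (Equiv.injective _)

theorem inv_mem_lagSet {B : Type w} {N : ℕ} {g : FreeGroup B} (h : g ∈ lagSet B N) :
    g⁻¹ ∈ lagSet B N := by
  obtain ⟨y, hy, rfl | rfl⟩ := h
  · exact ⟨y, hy, Or.inr rfl⟩
  · exact ⟨y, hy, Or.inl (inv_inv _)⟩

namespace Transducer

variable {Q : Type u} {A : Type v} {B : Type w} {E : Type x} {T : Transducer Q A B E}

/-! ### Lags of histories -/

/-- The output of a history. -/
def histOut (T : Transducer Q A B E) (c : List E) : List B := T.outWord c.reverse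

theorem histOut_cons (e : E) (c : List E) : T.histOut (e :: c) = T.histOut c ++ T.out e := by
  simp [histOut, outWord]

theorem histOut_append (c d : List E) : T.histOut (d ++ c) = T.histOut c ++ T.histOut d := by
  simp [histOut, outWord]

theorem mem_rel_iff {z : List A × List B} :
    z ∈ T.rel ↔ ∃ p c, (p, c) ∈ T.succHists z.1.reverse ∧ T.histOut c = z.2 := by
  constructor
  · rintro ⟨⟨p, c⟩, h, h'⟩
    refine ⟨p, c.reverse, ?_, by simpa [histOut] using h'⟩
    rw [Automaton.mem_succHists_iff]
    simpa using h
  · rintro ⟨p, c, h, h'⟩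
    rw [Automaton.mem_succHists_iff] at h
    exact ⟨(p, c.reverse), by simpa using h, h'⟩

/-- The lag of the history `d` with respect to the history `c`. -/
def lag (T : Transducer Q A B E) (d c : List E) : FreeGroup B :=
  (wordFG (T.histOut c))⁻¹ * wordFG (T.histOut d)

theorem lag_self (c : List E) : T.lag c c = 1 := inv_mul_cancel _

theorem lag_eq_one {d c : List E} (h : T.histOut d = T.histOut c) : T.lag d c = 1 := by
  rw [lag, h, inv_mul_cancel]

theorem histOut_eq_of_lag_eq_one {d c : List E} (h : T.lag d c = 1) : T.histOut d = T.histOut c :=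
  (wordFG_injective (inv_mul_eq_one.1 h)).symm

theorem lag_cons (f e : E) (d c : List E) :
    T.lag (f :: d) (e :: c) = (wordFG (T.out e))⁻¹ * T.lag d c * wordFG (T.out f) := by
  simp only [lag, histOut_cons, wordFG_append]
  group

theorem lag_cons_self (f e : E) (c : List E) :
    T.lag (f :: c) (e :: c) = (wordFG (T.out e))⁻¹ * wordFG (T.out f) := by
  rw [lag_cons, lag_self, mul_one]

theorem inv_lag (d c : List E) : (T.lag d c)⁻¹ = T.lag c d := by
  simp [lag]

/-- The lag of two histories of the same length belongs to `lagSet B N` at all times. -/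
def LagBounded (T : Transducer Q A B E) (N : ℕ) (d c : List E) : Prop :=
  ∀ m, T.lag (d.drop m) (c.drop m) ∈ lagSet B N

theorem lagBounded_cons {N : ℕ} {f e : E} {d c : List E} :
    T.LagBounded N (f :: d) (e :: c) ↔
      T.lag (f :: d) (e :: c) ∈ lagSet B N ∧ T.LagBounded N d c := by
  constructor
  · exact fun h => ⟨h 0, fun m => h (m + 1)⟩
  · rintro ⟨h, h'⟩ (_ | m)
    · exact h
    · exact h' m

theorem lagBounded_self (N : ℕ) (c : List E) : T.LagBounded N c c := fun m => by
  rw [lag_self]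
  exact one_mem_lagSet B N

theorem LagBounded.lag_mem {N : ℕ} {d c : List E} (h : T.LagBounded N d c) :
    T.lag d c ∈ lagSet B N := h 0

theorem LagBounded.symm {N : ℕ} {d c : List E} (h : T.LagBounded N d c) : T.LagBounded N c d :=
  fun m => by
    rw [← inv_lag]
    exact inv_mem_lagSet (h m)

theorem LagBounded.of_append {N : ℕ} {d c b : List E} (h : T.LagBounded N (b ++ d) (b ++ c)) :
    T.LagBounded N d c := fun m => by
  have h1 := h (b.length + m)
  rwa [List.drop_length_add_append, List.drop_length_add_append] at h1

/-- The bound on the lag of two among `k + 1` computations, for histories. -/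
theorem exists_histOut_eq_and_lagBounded [Finite Q] [Finite B] {k L : ℕ} (hk : T.KValued k)
    (hL1 : 1 ≤ L) (hL : ∀ e, (T.out e).length ≤ L) {u : List A} {c : Fin (k + 1) → Q × List E}
    (hc : ∀ i, c i ∈ T.succHists u) :
    ∃ i j, i ≠ j ∧ T.histOut (c i).2 = T.histOut (c j).2 ∧
      T.LagBounded (L * Nat.card Q ^ (k + 1)) (c i).2 (c j).2 := by
  obtain ⟨i, j, hij, h1, h2⟩ := exists_outWord_eq_and_lag_mem hk hL1 hL
    (c := fun i => ((c i).1, (c i).2.reverse)) (fun i => Automaton.mem_succHists_iff.1 (hc i))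
  refine ⟨i, j, hij, h1, LagBounded.symm fun m => ?_⟩
  have hlen : ∀ i, (c i).2.length = u.length := fun i => by rw [← (hc i).2, List.length_map]
  have h3 := h2 (u.length - m)
  simp only [List.take_reverse, hlen] at h3
  rcases le_total m u.length with hm | hm
  · rw [Nat.sub_sub_self hm] at h3
    rw [← inv_lag]
    exact inv_mem_lagSet (by simpa [lag, histOut] using inv_mem_lagSet h3)
  · rw [List.drop_eq_nil_of_le (by rw [hlen]; exact hm),
      List.drop_eq_nil_of_le (by rw [hlen]; exact hm), lag_self]
    exact one_mem_lagSet B _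

/-! ### The lag separation covering -/

/-- The initial vector of the lag separation covering. -/
def lagInit (T : Transducer Q A B E) (o : T.LexOrder) (N : ℕ) (p : Q) : LagVec Q B N :=
  fun r => {g : lagSet B N | o.ltInit r p ∧ (g : FreeGroup B) = 1}

theorem isCovering_lagSelect (T : Transducer Q A B E) (o : T.LexOrder) (N : ℕ) :
    T.toAutomaton.IsCovering (T.lagSelect o N).toAutomaton
      (fun e vec => (T.lagStep o N vec e).2) (T.lagInit o N) :=
  ⟨fun _ => rfl, fun _ => rfl, fun _ => rfl, fun _ => Iff.rfl⟩

/-- The vector of the lag separation covering at the end of a history. -/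
def lagVec (T : Transducer Q A B E) (o : T.LexOrder) (N : ℕ) (p : Q) (c : List E) : LagVec Q B N :=
  c.foldr (fun e vec => (T.lagStep o N vec e).2) (T.lagInit o N p)

/-- The vector of the lag separation covering records the lags of the smaller histories whose lag
has remained bounded. -/
theorem mem_lagVec {o : T.LexOrder} {N : ℕ} {p q r : Q} {c : List E}
    (hc : T.toAutomaton.Hist p c q) {g : lagSet B N} :
    g ∈ T.lagVec o N p c r ↔ ∃ p' d, T.toAutomaton.Hist p' d r ∧ o.Below p' p d c ∧
      T.lag d c = g ∧ T.LagBounded N d c := by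
  induction c generalizing q r g with
  | nil =>
    constructor
    · rintro ⟨h1, h2⟩
      exact ⟨r, [], Automaton.hist_nil.2 ⟨(o.ltInit_mem _ _ h1).1, rfl⟩, h1, by rw [lag_self, h2],
        lagBounded_self N []⟩
    · rintro ⟨p', d, h1, h2, h3, h4⟩
      cases d with
      | cons => exact h2.elim
      | nil =>
        obtain ⟨h5, rfl⟩ := Automaton.hist_nil.1 h1
        exact ⟨h2, by rw [← h3, lag_self]⟩
  | cons e c ih =>
    obtain ⟨rfl, hc'⟩ := Automaton.hist_cons.1 hc
    have hlag : ∀ {f : E} {d : List E}, T.lag (f :: d) (e :: c) = g →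
        T.lag (f :: d) (e :: c) ∈ lagSet B N := fun h => by
      rw [h]
      exact g.2
    constructor
    · rintro (⟨f, h1, rfl, g', h2, h3⟩ | ⟨f, h1, rfl, h2⟩)
      · obtain ⟨p', d, h4, h5, h6, h7⟩ := (ih hc').1 h2
        have h8 : T.lag (f :: d) (e :: c) = g := by rw [lag_cons, h6, h3]
        exact ⟨p', f :: d, Automaton.hist_cons.2 ⟨rfl, h4⟩, Or.inl ⟨h5, h1⟩, h8,
          lagBounded_cons.2 ⟨hlag h8, h7⟩⟩
      · have h8 : T.lag (f :: c) (e :: c) = g := by rw [lag_cons_self, h2]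
        refine ⟨p, f :: c, Automaton.hist_cons.2 ⟨rfl, ?_⟩, Or.inr ⟨rfl, rfl, h1⟩, h8,
          lagBounded_cons.2 ⟨hlag h8, lagBounded_self N c⟩⟩
        rw [(o.lt_same _ _ h1).1]
        exact hc'
    · rintro ⟨p', d, h1, h2, h3, h4⟩
      cases d with
      | nil => exact h2.elim
      | cons f d =>
        obtain ⟨h5, h6⟩ := Automaton.hist_cons.1 h1
        rcases h2 with ⟨h7, h8⟩ | ⟨rfl, rfl, h7⟩
        · have h9 := (lagBounded_cons.1 h4).2
          refine Or.inl ⟨f, h8, h5, ⟨T.lag d c, h9.lag_mem⟩, ?_, ?_⟩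
          · exact (ih hc').2 ⟨p', d, h6, h7, rfl, h9⟩
          · rw [← h3, lag_cons]
        · exact Or.inr ⟨f, h7, h5, by rw [← h3, lag_cons_self]⟩

theorem hist_lagSelect {o : T.LexOrder} {N : ℕ} {s z : Q × LagVec Q B N}
    {C : List (T.CovTrans (LagVec Q B N))} (h : (T.lagSelect o N).Hist s C z) :
    T.toAutomaton.Hist s.1 (T.covProj C) z.1 ∧ z.2 = T.lagVec o N s.1 (T.covProj C) :=
  ⟨((T.isCovering_lagSelect o N).hist h).1, ((T.isCovering_lagSelect o N).hist h).2.2⟩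

theorem histOut_lagSelect (o : T.LexOrder) (N : ℕ) (C : List (T.CovTrans (LagVec Q B N))) :
    (T.lagSelect o N).histOut C = T.histOut (T.covProj C) := by
  simp only [histOut, outWord, Automaton.covProj, ← List.map_reverse, List.map_map]
  rfl

/-- A state `(p, v)` with `1 ∈ v p` is useless. -/
theorem not_coaccessible_of_one_mem {o : T.LexOrder} {N : ℕ} {z : Q × LagVec Q B N}
    {g : lagSet B N} (hg : (g : FreeGroup B) = 1) (h : g ∈ z.2 z.1) :
    ¬ (T.lagSelect o N).Coaccessible z := by
  rintro ⟨t, ht, c, hc⟩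
  induction c generalizing z g with
  | nil =>
    obtain rfl : z = t := hc
    exact ht.2 _ ht.1 g h hg
  | cons e c ih =>
    obtain ⟨rfl, hc'⟩ := hc
    refine ih (g := ⟨1, one_mem_lagSet B N⟩) rfl ?_ hc'
    refine Or.inl ⟨e.1.2, rfl, rfl, g, ?_, by simp [hg]⟩
    rw [e.2]
    exact h

/-- Among `k + 1` distinct histories with the same input, continued by a common sequence of
transitions into successful computations, one sees the empty lag in its vector. -/
theorem exists_one_mem_lagVec [Finite Q] [Finite B] {k L : ℕ} (hk : T.KValued k)
    (hL1 : 1 ≤ L) (hL : ∀ e, (T.out e).length ≤ L) (o : T.LexOrder) {u : List A}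
    {c : Fin (k + 1) → Q × List E} (hinj : Function.Injective c) {z t : Fin (k + 1) → Q}
    {d : List E} (hc : ∀ i, T.toAutomaton.Hist (c i).1 (c i).2 (z i))
    (hu : ∀ i, (c i).2.map T.inp = u) (hd : ∀ i, T.IsComp (z i) d (t i))
    (ht : ∀ i, t i ∈ T.final) :
    ∃ i j, (⟨1, one_mem_lagSet B _⟩ : lagSet B (L * Nat.card Q ^ (k + 1))) ∈
      T.lagVec o (L * Nat.card Q ^ (k + 1)) (c j).1 (c j).2 (z i) := by
  obtain ⟨i, j, hij, h1, h2⟩ := exists_histOut_eq_and_lagBounded hk hL1 hL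
    (c := fun i => ((c i).1, d.reverse ++ (c i).2)) (u := (d.map T.inp).reverse ++ u) (fun i => by
      refine ⟨⟨t i, ht i, (hc i).1, ?_⟩, by simp [hu]⟩
      rw [List.reverse_append, List.reverse_reverse]
      exact Automaton.isComp_append.2 ⟨z i, (hc i).2, hd i⟩)
  simp only [histOut_append, List.append_cancel_right_eq] at h1
  replace h2 := h2.of_append
  have h3 : ∀ i j, T.histOut (c i).2 = T.histOut (c j).2 →
      T.LagBounded (L * Nat.card Q ^ (k + 1)) (c i).2 (c j).2 →
      o.Below (c i).1 (c j).1 (c i).2 (c j).2 →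
      (⟨1, one_mem_lagSet B _⟩ : lagSet B (L * Nat.card Q ^ (k + 1))) ∈
      T.lagVec o (L * Nat.card Q ^ (k + 1)) (c j).1 (c j).2 (z i) := fun i j h1 h2 h3 =>
    (mem_lagVec (hc j)).2 ⟨_, _, hc i, h3, lag_eq_one h1, h2⟩
  rcases o.below_total (hc i) (hc j) (by rw [hu, hu]) (fun h => hij (hinj h)) with h4 | h4
  · exact ⟨i, j, h3 i j h1 h2 h4⟩
  · exact ⟨j, i, h3 j i h1.symm h2.symm h4⟩

theorem covProj_family_injective {o : T.LexOrder} {N : ℕ} {I : Type*}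
    {c : I → (Q × LagVec Q B N) × List (T.CovTrans (LagVec Q B N))}
    (hinj : Function.Injective c) {z : I → Q × LagVec Q B N}
    (hz : ∀ i, (T.lagSelect o N).Hist (c i).1 (c i).2 (z i)) :
    Function.Injective fun i => ((c i).1.1, T.covProj (c i).2) := by
  intro i j h
  obtain ⟨h1, h2⟩ := Prod.ext_iff.1 h
  obtain ⟨h3, h4⟩ := (T.isCovering_lagSelect o N).injective (hz i) (hz j) h1 h2
  exact hinj (Prod.ext h3 h4)

theorem map_inp_lagSelect (o : T.LexOrder) (N : ℕ) (C : List (T.CovTrans (LagVec Q B N))) :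
    (T.covProj C).map T.inp = C.map (T.lagSelect o N).inp :=
  (T.isCovering_lagSelect o N).map_inp C

theorem isAmbiguousAtMost_lagSelect [Finite Q] [Finite B] {k L : ℕ} (hk : T.KValued k)
    (hL1 : 1 ≤ L) (hL : ∀ e, (T.out e).length ≤ L) (o : T.LexOrder) :
    (T.lagSelect o (L * Nat.card Q ^ (k + 1))).IsAmbiguousAtMost k := by
  rw [Automaton.isAmbiguousAtMost_iff]
  intro u
  by_contra hlt
  obtain ⟨c, hinj, hc⟩ := exists_injective_of_lt_encard (not_le.1 hlt)
  choose hz hu using hc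
  choose z hzf hz using hz
  obtain ⟨i, j, h⟩ := exists_one_mem_lagVec hk hL1 hL o (covProj_family_injective hinj hz)
    (fun i => (hist_lagSelect (hz i)).1) (fun i => by rw [map_inp_lagSelect, hu i]) (d := [])
    (fun i => rfl) (fun i => (hzf i).1)
  rw [← (hist_lagSelect (hz j)).2] at h
  exact (hzf j).2 _ (hzf i).1 _ h rfl

/-- At most `k` histories with the same input end in useful states over a given state. -/
theorem encard_coaccessible_hist_le [Finite Q] [Finite B] {k L : ℕ} (hT : T.IsTrim)
    (hk : T.KValued k) (hL1 : 1 ≤ L) (hL : ∀ e, (T.out e).length ≤ L) (o : T.LexOrder) (r : Q)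
    (u : List A) :
    {c : _ × List _ | (∃ z, z.1 = r ∧ (T.lagSelect o (L * Nat.card Q ^ (k + 1))).Hist c.1 c.2 z ∧
      (T.lagSelect o (L * Nat.card Q ^ (k + 1))).Coaccessible z) ∧
      c.2.map (T.lagSelect o (L * Nat.card Q ^ (k + 1))).inp = u}.encard ≤ k := by
  by_contra hlt
  obtain ⟨c, hinj, hc⟩ := exists_injective_of_lt_encard (not_le.1 hlt)
  choose hz hu using hc
  choose z hzr hz hzc using hz
  obtain ⟨t, ht, d, hd⟩ := (hT r).2
  obtain ⟨i, j, h⟩ := exists_one_mem_lagVec hk hL1 hL o (covProj_family_injective hinj hz)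
    (fun i => (hist_lagSelect (hz i)).1) (fun i => by rw [map_inp_lagSelect, hu i]) (d := d)
    (t := fun _ => t) (fun i => by rw [hzr i]; exact hd) (fun i => ht)
  rw [← (hist_lagSelect (hz j)).2, hzr i, ← hzr j] at h
  exact not_coaccessible_of_one_mem rfl h (hzc j)

/-- The removal of final states does not change the relation: the smallest of the successful
computations with a given input and a given output is kept. -/
theorem rel_lagSelect [Finite Q] [Finite E] (o : T.LexOrder) (N : ℕ) :
    (T.lagSelect o N).rel = T.rel := by
  ext ⟨u, w⟩
  rw [mem_rel_iff, mem_rel_iff]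
  constructor
  · rintro ⟨s, C, ⟨⟨z, hz, h⟩, hu⟩, rfl⟩
    exact ⟨s.1, T.covProj C, ⟨⟨z.1, hz.1, (hist_lagSelect h).1⟩, by rw [map_inp_lagSelect, hu]⟩,
      (histOut_lagSelect o N C).symm⟩
  · rintro ⟨p₀, c₀, h₀, hw₀⟩
    set S : Set (Q × List E) := {c | c ∈ T.succHists u.reverse ∧ T.histOut c.2 = w} with hS
    have hfin : S.Finite := by
      refine ((Set.toFinite Set.univ).prod (List.finite_length_eq E u.length)).subset ?_
      rintro ⟨p, c⟩ ⟨⟨-, h⟩, -⟩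
      refine ⟨trivial, ?_⟩
      have := congrArg List.length h
      simpa using this
    have : Finite S := hfin
    let R : S → S → Prop := fun c d => o.Below c.1.1 d.1.1 c.1.2 d.1.2
    have : IsTrans S R := ⟨fun _ _ _ h h' => h.trans h'⟩
    have : Std.Irrefl R := ⟨fun c => o.below_irrefl _ _⟩
    obtain ⟨⟨⟨p, c⟩, ⟨⟨q, hq, hc⟩, hu⟩, hw⟩, -, hmin⟩ :=
      (Finite.wellFounded_of_trans_of_irrefl R).has_min Set.univ ⟨⟨(p₀, c₀), h₀, hw₀⟩, trivial⟩
    obtain ⟨C, hC, rfl⟩ := (T.isCovering_lagSelect o N).lift hc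
    refine ⟨_, C, ⟨⟨_, ⟨hq, ?_⟩, hC⟩, by rw [← map_inp_lagSelect, hu]⟩, by
      rw [histOut_lagSelect, hw]⟩
    intro t ht g hg hg1
    obtain ⟨p', d, h1, h2, h3, -⟩ := (mem_lagVec hc).1 hg
    refine hmin ⟨(p', d), ⟨⟨t, ht, h1⟩, ?_⟩, ?_⟩ trivial h2
    · rw [← hu]
      exact h2.map_inp
    · rw [← hw]
      exact histOut_eq_of_lag_eq_one (h3.trans hg1)

end Transducer

/-! ### The number of states of the lag separation covering -/

/-- A finite type with at most `m` elements is enumerated without repetition by `Fin m`, with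
blanks. -/
theorem exists_enumeration {β : Type*} [Finite β] {m : ℕ} (h : Nat.card β ≤ m) :
    ∃ (f : Fin m → Option β) (e : β → Fin m), ∀ b j, f j = some b ↔ e b = j := by
  have : Fintype β := Fintype.ofFinite β
  obtain ⟨e⟩ := Function.Embedding.nonempty_of_card_le (α := β) (β := Fin m)
    (by rwa [Fintype.card_fin, ← Nat.card_eq_fintype_card])
  exact ⟨Function.partialInv e, e, e.injective.isPartialInv⟩

theorem exists_setOf_some_eq {α : Type*} {s : Set α} {m : ℕ} (h : s.encard ≤ m) :
    ∃ f : Fin m → Option α, {a | ∃ j, f j = some a} = s := by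
  have hfin : s.Finite := Set.finite_of_encard_le_coe h
  have : Finite s := hfin
  obtain ⟨f, e, hfe⟩ := exists_enumeration (β := s) (m := m) (by
    rw [Nat.card_coe_set_eq]
    exact_mod_cast hfin.cast_ncard_eq.trans_le h)
  refine ⟨fun j => (f j).map Subtype.val, Set.ext fun a => ⟨?_, fun ha => ?_⟩⟩
  · rintro ⟨j, hj⟩
    obtain ⟨b, -, rfl⟩ := Option.map_eq_some_iff.1 hj
    exact b.2
  · exact ⟨e ⟨a, ha⟩, by simp only [(hfe ⟨a, ha⟩ _).2 rfl, Option.map_some]⟩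

theorem card_words_le (B : Type w) [Finite B] (N : ℕ) :
    {y : List B | y.length ≤ N}.ncard ≤ (Nat.card B + 1) ^ N := by
  -- a word is padded with blanks
  have h := Set.ncard_le_ncard_of_injOn (s := {y : List B | y.length ≤ N})
    (t := (Set.univ : Set (Fin N → Option B))) (fun y j => y[(j : ℕ)]?) (fun _ _ => trivial) (by
      intro y hy z hz hyz
      apply List.ext_getElem?
      intro j
      rcases lt_or_ge j N with hj | hj
      · exact congrFun hyz ⟨j, hj⟩
      · rw [List.getElem?_eq_none (le_trans hy hj), List.getElem?_eq_none (le_trans hz hj)])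
    Set.finite_univ
  rwa [Set.ncard_univ, Nat.card_fun, Finite.card_option, Nat.card_eq_fintype_card (α := Fin N),
    Fintype.card_fin] at h

theorem card_lagSet_add_one_le (B : Type w) [Finite B] (N : ℕ) :
    Nat.card (lagSet B N) + 1 ≤ 2 ^ (Nat.card B * N + 1) := by
  set W := {y : List B | y.length ≤ N} with hW
  have hWf : W.Finite := List.finite_length_le B N
  have hsub : lagSet B N ⊆ wordFG '' W ∪ (fun y => (wordFG y)⁻¹) '' (W \ {[]}) := by
    rintro g ⟨y, hy, rfl | rfl⟩
    · exact Or.inl ⟨y, hy, rfl⟩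
    · by_cases h : y = []
      · exact Or.inl ⟨y, hy, by simp [h, wordFG_nil]⟩
      · exact Or.inr ⟨y, ⟨hy, h⟩, rfl⟩
  have h1 := Set.ncard_le_ncard hsub ((hWf.image _).union (hWf.sdiff.image _))
  have h2 := Set.ncard_union_le (wordFG '' W) ((fun y => (wordFG y)⁻¹) '' (W \ {[]}))
  have h3 := Set.ncard_image_le (f := (wordFG : List B → FreeGroup B)) hWf
  have h4 := Set.ncard_image_le (f := fun y : List B => (wordFG y)⁻¹) (hWf.sdiff (t := {[]}))
  have h5 := Set.ncard_sdiff_singleton_add_one (show [] ∈ W from Nat.zero_le _) hWf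
  have h6 : W.ncard ≤ 2 ^ (Nat.card B * N) := by
    refine (card_words_le B N).trans ?_
    rw [pow_mul]
    exact Nat.pow_le_pow_left (Nat.lt_two_pow_self) N
  rw [Nat.card_coe_set_eq, pow_succ]
  omega

namespace Transducer

variable {Q : Type u} {A : Type v} {B : Type w} {E : Type x} {T : Transducer Q A B E}

theorem one_le_of_isTrim [Nonempty Q] {k : ℕ} (hT : T.IsTrim) (hk : T.KValued k) : 1 ≤ k := by
  obtain ⟨q⟩ := ‹Nonempty Q›
  obtain ⟨⟨p, hp, c, hc⟩, t, ht, d, hd⟩ := hT q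
  have h1 : T.outWord (c ++ d) ∈ {z | ((c ++ d).map T.inp, z) ∈ T.rel} :=
    ⟨(p, c ++ d), ⟨hp, ⟨t, ht, Automaton.isComp_append.2 ⟨q, hc, hd⟩⟩, rfl⟩, rfl⟩
  have h2 := (Set.one_le_encard_iff_nonempty.2 ⟨_, h1⟩).trans (hk _)
  exact_mod_cast h2

theorem encard_histOut_le {k : ℕ} (hT : T.IsTrim) (hk : T.KValued k) (r : Q) (u : List A) :
    {w | ∃ p c, T.toAutomaton.Hist p c r ∧ c.map T.inp = u ∧ T.histOut c = w}.encard ≤ k := by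
  obtain ⟨t, ht, d, hd⟩ := (hT r).2
  have hinj : Function.Injective fun w => w ++ T.outWord d := fun a b h =>
    List.append_cancel_right h
  rw [← hinj.encard_image]
  refine (Set.encard_le_encard ?_).trans (hk (u.reverse ++ d.map T.inp))
  rintro _ ⟨_, ⟨p, c, hc, rfl, rfl⟩, rfl⟩
  exact ⟨(p, c.reverse ++ d), ⟨hc.1, ⟨t, ht, Automaton.isComp_append.2 ⟨r, hc.2, hd⟩⟩, by simp⟩,
    outWord_append _ _⟩

theorem encard_vec_le_of_accessible {k N : ℕ} (hT : T.IsTrim) (hk : T.KValued k) {o : T.LexOrder}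
    {z : Q × LagVec Q B N} (hz : (T.lagSelect o N).Accessible z) (r : Q) :
    (z.2 r).encard ≤ k := by
  obtain ⟨s, C, hC⟩ := hz.exists_hist
  obtain ⟨hc, hv⟩ := hist_lagSelect hC
  rw [← Subtype.val_injective.encard_image]
  refine (Set.encard_le_encard ?_).trans ((Set.encard_image_le
    (fun w => (wordFG (T.histOut (T.covProj C)))⁻¹ * wordFG w) _).trans
    (encard_histOut_le hT hk r ((T.covProj C).map T.inp)))
  rintro _ ⟨g, hg, rfl⟩
  rw [hv] at hg
  obtain ⟨p', d, h1, h2, h3, -⟩ := (mem_lagVec hc).1 hg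
  exact ⟨T.histOut d, ⟨p', d, h1, h2.map_inp, rfl⟩, h3⟩

/-- In a single-valued transducer, the computations that end in `p` with a given input have the same
output, so that `v p` can only contain the empty lag, which would make the state `(p, v)`
useless. -/
theorem vec_self_eq_empty {N : ℕ} (hT : T.IsTrim) (hk : T.KValued 1) {o : T.LexOrder}
    {z : Q × LagVec Q B N} (hz : (T.lagSelect o N).Useful z) : z.2 z.1 = ∅ := by
  obtain ⟨s, C, hC⟩ := hz.1.exists_hist
  obtain ⟨hc, hv⟩ := hist_lagSelect hC
  rw [Set.eq_empty_iff_forall_notMem]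
  intro g hg
  have hg' := hg
  rw [hv] at hg'
  obtain ⟨p', d, h1, h2, h3, -⟩ := (mem_lagVec hc).1 hg'
  refine not_coaccessible_of_one_mem ?_ hg hz.2
  rw [← h3]
  exact lag_eq_one (Set.encard_le_one_iff.1
    (encard_histOut_le hT hk z.1 ((T.covProj C).map T.inp)) _ _
    ⟨p', d, h1, h2.map_inp, rfl⟩ ⟨s.1, _, hc, rfl, rfl⟩)

theorem encard_useful_lagSelect_le [Finite Q] [Finite B] {k N : ℕ} (hT : T.IsTrim)
    (hk : T.KValued k) (o : T.LexOrder) :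
    {s | (T.lagSelect o N).Useful s}.encard ≤
      ((Nat.card Q * ((Nat.card (lagSet B N) + 1) ^ k) ^ Nat.card Q : ℕ) : ℕ∞) := by
  have hsub : {s | (T.lagSelect o N).Useful s} ⊆
      (fun z : Q × (Q → Fin k → Option (lagSet B N)) =>
        ((z.1, fun r => {g | ∃ j, z.2 r j = some g}) : Q × LagVec Q B N)) '' Set.univ := by
    intro z hz
    choose f hf using fun r => exists_setOf_some_eq (encard_vec_le_of_accessible hT hk hz.1 r)
    exact ⟨(z.1, f), trivial, Prod.ext rfl (funext hf)⟩
  refine (Set.encard_le_encard hsub).trans ((Set.encard_image_le _ _).trans ?_)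
  rw [Set.encard_univ, ENat.card_eq_coe_natCard, Nat.card_prod, Nat.card_fun, Nat.card_fun,
    Finite.card_option, Nat.card_eq_fintype_card (α := Fin k), Fintype.card_fin]

theorem encard_useful_lagSelect_le_of_kValued_one [Finite Q] [Finite B] {N : ℕ} (hT : T.IsTrim)
    (hk : T.KValued 1) (o : T.LexOrder) :
    {s | (T.lagSelect o N).Useful s}.encard ≤
      ((Nat.card Q * (Nat.card (lagSet B N) + 1) ^ (Nat.card Q - 1) : ℕ) : ℕ∞) := by
  classical
  have hsub : {s | (T.lagSelect o N).Useful s} ⊆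
      (fun z : (p : Q) × ({r // r ≠ p} → Fin 1 → Option (lagSet B N)) =>
        ((z.1, fun r => {g | ∃ (h : r ≠ z.1) (j : Fin 1), z.2 ⟨r, h⟩ j = some g}) :
          Q × LagVec Q B N)) '' Set.univ := by
    intro z hz
    choose f hf using fun r => exists_setOf_some_eq (encard_vec_le_of_accessible hT hk hz.1 r)
    refine ⟨⟨z.1, fun r => f r.1⟩, trivial, Prod.ext rfl (funext fun r => ?_)⟩
    by_cases h : r = z.1
    · subst h
      rw [vec_self_eq_empty hT hk hz]
      exact Set.eq_empty_iff_forall_notMem.2 fun g hg => hg.1 rfl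
    · rw [← hf r]
      exact Set.ext fun g => ⟨fun hg => hg.2, fun hg => ⟨h, hg⟩⟩
  have : Fintype Q := Fintype.ofFinite Q
  refine (Set.encard_le_encard hsub).trans ((Set.encard_image_le _ _).trans ?_)
  rw [Set.encard_univ, ENat.card_eq_coe_natCard, Nat.card_sigma]
  have h1 : ∀ p : Q, Nat.card ({r // r ≠ p} → Fin 1 → Option (lagSet B N)) =
      (Nat.card (lagSet B N) + 1) ^ (Nat.card Q - 1) := by
    intro p
    rw [Nat.card_fun, Nat.card_fun, Finite.card_option, Nat.card_eq_fintype_card (α := Fin 1),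
      Fintype.card_fin, pow_one, Nat.card_eq_fintype_card (α := {r // r ≠ p}),
      Nat.card_eq_fintype_card (α := Q)]
    congr 1
    exact Set.card_ne_eq p
  rw [Finset.sum_congr rfl fun p _ => h1 p, Finset.sum_const, Finset.card_univ, smul_eq_mul,
    Nat.card_eq_fintype_card (α := Q)]

/-- The bound on the number of useful states of the lag separation covering. -/
theorem encard_useful_lagSelect_le_two_pow [Finite Q] [Finite B] {k N : ℕ} (hT : T.IsTrim)
    (hk : T.KValued k) (o : T.LexOrder) (hB : 1 ≤ Nat.card B) (hN : 1 ≤ N)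
    (hex : ¬ (Nat.card B = 1 ∧ N = 1 ∧ k = 1 ∧ 5 ≤ Nat.card Q)) :
    {s | (T.lagSelect o N).Useful s}.encard ≤
      ((2 ^ (2 * Nat.card B * N * k ^ 2 * Nat.card Q) : ℕ) : ℕ∞) := by
  rcases isEmpty_or_nonempty Q with hQ | hQ
  · rw [Set.encard_eq_zero.2 (Set.eq_empty_of_isEmpty _)]
    exact zero_le
  have hk1 := one_le_of_isTrim hT hk
  have hD := card_lagSet_add_one_le B N
  set D := Nat.card (lagSet B N) with hDdef
  set n := Nat.card Q with hn
  have hBN : 1 ≤ Nat.card B * N := Nat.mul_le_mul hB hN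
  by_cases h1 : Nat.card B * N = 1 ∧ k = 1
  · obtain ⟨h1, rfl⟩ := h1
    have h2 : Nat.card B = 1 := Nat.eq_one_of_mul_eq_one_right h1
    have h3 : N = 1 := Nat.eq_one_of_mul_eq_one_left h1
    have hn4 : n ≤ 4 := by
      by_contra hlt
      exact hex ⟨h2, h3, rfl, by omega⟩
    refine (encard_useful_lagSelect_le_of_kValued_one hT hk o).trans ?_
    rw [h1] at hD
    rw [Nat.cast_le]
    calc n * (D + 1) ^ (n - 1) ≤ n * 4 ^ (n - 1) :=
          Nat.mul_le_mul_left _ (Nat.pow_le_pow_left hD _)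
      _ ≤ 2 ^ (2 * 1 * 1 * 1 ^ 2 * n) := by interval_cases n <;> norm_num
      _ = 2 ^ (2 * Nat.card B * N * 1 ^ 2 * n) := by rw [h2, h3]
  · refine (encard_useful_lagSelect_le hT hk o).trans ?_
    rw [Nat.cast_le]
    generalize ha : Nat.card B * N = a at *
    have hexp : k * (a + 1) + 1 ≤ 2 * a * k ^ 2 := by
      by_cases hk2 : k = 1
      · subst hk2
        have : a ≠ 1 := fun h => h1 ⟨h, rfl⟩
        omega
      · have : 2 ≤ k := by omega
        nlinarith [Nat.mul_le_mul hBN hk1, Nat.mul_le_mul (Nat.mul_le_mul hBN this) hk1,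
          Nat.mul_le_mul_left (a * k) this]
    calc n * ((D + 1) ^ k) ^ n ≤ 2 ^ n * ((2 ^ (a + 1)) ^ k) ^ n :=
          Nat.mul_le_mul Nat.lt_two_pow_self.le
            (Nat.pow_le_pow_left (Nat.pow_le_pow_left hD _) _)
      _ = 2 ^ ((k * (a + 1) + 1) * n) := by
          rw [← pow_mul, ← pow_mul, ← pow_add]
          congr 1
          ring
      _ ≤ 2 ^ (2 * a * k ^ 2 * n) :=
          Nat.pow_le_pow_right (by norm_num) (Nat.mul_le_mul_right _ hexp)
      _ = 2 ^ (2 * Nat.card B * N * k ^ 2 * n) := by rw [← ha, mul_assoc 2 (Nat.card B) N]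

end Transducer

/-! ### The multi-skimming covering -/

theorem trunc_eq_trunc_iff {k a b : ℕ} : trunc k a = trunc k b ↔ min a k = min b k := by
  simp [trunc, Fin.ext_iff]

/-- The projection onto `Trunc k` is compatible with the linear combinations. -/
theorem trunc_sum_trunc {Q : Type*} [Fintype Q] (k : ℕ) (a m : Q → ℕ) (s : ℕ) :
    trunc k (∑ q, (trunc k (a q) : ℕ) * m q + s) = trunc k (∑ q, a q * m q + s) := by
  rw [trunc_eq_trunc_iff]
  have hle : ∑ q, (trunc k (a q) : ℕ) * m q ≤ ∑ q, a q * m q :=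
    Finset.sum_le_sum fun q _ => Nat.mul_le_mul_right _ (min_le_left _ _)
  -- one truncated term with a nonzero coefficient makes both sums at least `k`
  by_cases h : ∃ q, k < a q ∧ m q ≠ 0
  · obtain ⟨q, h1, h2⟩ := h
    have h3 : k ≤ (trunc k (a q) : ℕ) * m q := by
      simp only [trunc, min_eq_right h1.le]
      exact Nat.le_mul_of_pos_right k (Nat.pos_of_ne_zero h2)
    have h4 := Finset.single_le_sum (f := fun q => (trunc k (a q) : ℕ) * m q)
      (fun q _ => Nat.zero_le _) (Finset.mem_univ q)
    omega
  · push Not at h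
    congr 2
    refine Finset.sum_congr rfl fun q _ => ?_
    by_cases h1 : k < a q
    · rw [h q h1, mul_zero, mul_zero]
    · simp only [trunc, min_eq_left (not_lt.1 h1)]

namespace Automaton

variable {Q : Type u} {A : Type v} {E : Type x} {M : Automaton Q A E}

/-- The histories smaller than `(p, c)` that end in `r`. -/
abbrev BelowEnd (M : Automaton Q A E) (o : M.LexOrder) (p : Q) (c : List E) (r : Q) :
    Type (max u x) :=
  {d : Q × List E // M.Hist d.1 d.2 r ∧ o.Below d.1 p d.2 c}

/-- The successful computations smaller than `(p, c)`, as histories. -/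
def succBelow (M : Automaton Q A E) (o : M.LexOrder) (p : Q) (c : List E) : Set (Q × List E) :=
  {d | (∃ r ∈ M.final, M.Hist d.1 d.2 r) ∧ o.Below d.1 p d.2 c}

theorem finite_setOf_below [Finite Q] [Finite E] (o : M.LexOrder) (p : Q) (c : List E) :
    {d : Q × List E | o.Below d.1 p d.2 c}.Finite := by
  refine ((Set.toFinite Set.univ).prod (List.finite_length_eq E c.length)).subset ?_
  rintro ⟨q, d⟩ h
  refine ⟨trivial, ?_⟩
  have := congrArg List.length (LexOrder.Below.map_inp h)
  simpa using this

instance [Finite Q] [Finite E] (o : M.LexOrder) (p : Q) (c : List E) (r : Q) :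
    Finite (M.BelowEnd o p c r) :=
  ((finite_setOf_below o p c).subset fun _ h => h.2).to_subtype

open Classical in
theorem card_belowEnd_nil {o : M.LexOrder} {p r : Q} :
    Nat.card (M.BelowEnd o p [] r) = if o.ltInit r p then 1 else 0 := by
  split_ifs with h
  · rw [Nat.card_eq_one_iff_unique]
    refine ⟨⟨?_⟩, ⟨⟨(r, []), hist_nil.2 ⟨(o.ltInit_mem _ _ h).1, rfl⟩, h⟩⟩⟩
    have key : ∀ d : M.BelowEnd o p [] r, d.1 = (r, []) := by
      rintro ⟨⟨q, d⟩, h1, h2⟩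
      cases d with
      | nil =>
        obtain ⟨-, rfl⟩ := hist_nil.1 h1
        rfl
      | cons => exact h2.elim
    exact fun a b => Subtype.ext ((key a).trans (key b).symm)
  · rw [Nat.card_eq_zero]
    left
    constructor
    rintro ⟨⟨q, d⟩, h1, h2⟩
    cases d with
    | nil =>
      obtain ⟨-, rfl⟩ := hist_nil.1 h1
      exact h h2
    | cons => exact h2.elim

/-- A history smaller than `e :: c` extends a history smaller than `c`, or extends `c` by a
transition smaller than `e`. -/
theorem card_belowEnd_cons [Fintype Q] [Finite E] {o : M.LexOrder} {p r : Q} {e : E} {c : List E}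
    (hc : M.Hist p c (M.src e)) :
    Nat.card (M.BelowEnd o p (e :: c) r) =
      ∑ q, Nat.card (M.BelowEnd o p c q) * M.mult q (M.inp e) r + M.smaller o e r := by
  simp only [mult, smaller, ← Nat.card_prod]
  rw [← Nat.card_sigma, ← Nat.card_sum]
  refine Nat.card_congr (Equiv.ofBijective (Sum.elim
    (fun z => ⟨(z.2.1.1.1, z.2.2.1 :: z.2.1.1.2), hist_cons.2 ⟨z.2.2.2.2.2, by
      rw [z.2.2.2.1]
      exact z.2.1.2.1⟩,
      Or.inl ⟨z.2.1.2.2, z.2.2.2.2.1⟩⟩)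
    (fun f => ⟨(p, f.1 :: c), hist_cons.2 ⟨f.2.2, by
      rw [(o.lt_same _ _ f.2.1).1]
      exact hc⟩, Or.inr ⟨rfl, rfl, f.2.1⟩⟩)) ⟨?_, ?_⟩).symm
  · rintro (⟨q, ⟨⟨p₁, d₁⟩, h1, h2⟩, ⟨f₁, rfl, h3, h4⟩⟩ | ⟨f₁, h1, h2⟩)
      (⟨q', ⟨⟨p₂, d₂⟩, h1', h2'⟩, ⟨f₂, rfl, h3', h4'⟩⟩ | ⟨f₂, h1', h2'⟩) h <;>
    simp only [Sum.elim_inl, Sum.elim_inr, Subtype.mk.injEq, Prod.mk.injEq, List.cons.injEq] at h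
    · obtain ⟨rfl, rfl, rfl⟩ := h
      rfl
    · obtain ⟨rfl, rfl, rfl⟩ := h
      exact absurd h2 (o.below_irrefl _ _)
    · obtain ⟨rfl, rfl, rfl⟩ := h
      exact absurd h2' (o.below_irrefl _ _)
    · obtain ⟨-, rfl, -⟩ := h
      rfl
  · rintro ⟨⟨q, d⟩, h1, h2⟩
    cases d with
    | nil => exact h2.elim
    | cons f d =>
      obtain ⟨h3, h4⟩ := hist_cons.1 h1
      rcases h2 with ⟨h5, h6⟩ | ⟨h5, h6, h7⟩
      · exact ⟨Sum.inl ⟨M.src f, ⟨(q, d), h4, h5⟩, ⟨f, rfl, h6, h3⟩⟩, rfl⟩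
      · refine ⟨Sum.inr ⟨f, h7, h3⟩, ?_⟩
        simp only at h5 h6
        subst h5 h6
        rfl

open Classical in
theorem ncard_succBelow [Fintype Q] [Finite E] (o : M.LexOrder) (p : Q) (c : List E) :
    (M.succBelow o p c).ncard =
      ∑ r, Nat.card (M.BelowEnd o p c r) * (if r ∈ M.final then 1 else 0) := by
  have h : ∀ r, Nat.card (M.BelowEnd o p c r) * (if r ∈ M.final then 1 else 0) =
      Nat.card (M.BelowEnd o p c r × {_x : Unit // r ∈ M.final}) := by
    intro r
    rw [Nat.card_prod]
    congr 1
    split_ifs with hr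
    · simp [hr]
    · simp [hr]
  rw [Finset.sum_congr rfl fun r _ => h r, ← Nat.card_sigma, ← Nat.card_coe_set_eq]
  refine Nat.card_congr (Equiv.ofBijective
    (fun z => ⟨z.2.1.1, ⟨z.1, z.2.2.2, z.2.1.2.1⟩, z.2.1.2.2⟩) ⟨?_, ?_⟩).symm
  · rintro ⟨r, ⟨d, h1, h2⟩, x, h3⟩ ⟨r', ⟨d', h1', h2'⟩, x', h3'⟩ h
    obtain rfl : d = d' := congrArg Subtype.val h
    obtain rfl := h1.end_unique h1'
    rfl
  · rintro ⟨d, ⟨r, h1, h2⟩, h3⟩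
    exact ⟨⟨r, ⟨d, h2, h3⟩, (), h1⟩, rfl⟩

section Skim

variable {k i : ℕ}

/-- The update of the vectors of the multi-skimming covering. -/
noncomputable def skimStep (M : Automaton Q A E) (o : M.LexOrder) (k : ℕ) (e : E)
    (vec : Q → Trunc k) : Q → Trunc k := fun r =>
  trunc k ((∑ᶠ q : Q, (vec q : ℕ) * M.mult q (M.inp e) r) + M.smaller o e r)

open Classical in
/-- The initial vector of the multi-skimming covering. -/
noncomputable def skimInit (M : Automaton Q A E) (o : M.LexOrder) (k : ℕ) (p : Q) :
    Q → Trunc k := fun r => trunc k (if o.ltInit r p then 1 else 0)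

theorem isCovering_skim (M : Automaton Q A E) (o : M.LexOrder) (k i : ℕ) :
    M.IsCovering (M.skim o k i) (M.skimStep o k) (M.skimInit o k) :=
  ⟨fun _ => rfl, fun _ => rfl, fun _ => rfl, fun _ => Iff.rfl⟩

/-- The vector of the multi-skimming covering counts the smaller histories by their ends. -/
theorem foldr_skimStep [Finite Q] [Finite E] {o : M.LexOrder} {p q : Q} {c : List E}
    (hc : M.Hist p c q) :
    c.foldr (M.skimStep o k) (M.skimInit o k p) =
      fun r => trunc k (Nat.card (M.BelowEnd o p c r)) := by
  induction c generalizing q with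
  | nil =>
    funext r
    rw [card_belowEnd_nil]
    rfl
  | cons e c ih =>
    have : Fintype Q := Fintype.ofFinite Q
    obtain ⟨-, hc'⟩ := hist_cons.1 hc
    rw [List.foldr_cons, ih hc']
    funext r
    rw [skimStep, finsum_eq_sum_of_fintype, card_belowEnd_cons hc', trunc_sum_trunc]

theorem hist_skim [Finite Q] [Finite E] {o : M.LexOrder} {s z : Q × (Q → Trunc k)}
    {C : List (M.CovTrans (Q → Trunc k))} (h : (M.skim o k i).Hist s C z) :
    M.Hist s.1 (M.covProj C) z.1 ∧
      z.2 = fun r => trunc k (Nat.card (M.BelowEnd o s.1 (M.covProj C) r)) := by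
  have h1 := (M.isCovering_skim o k i).hist h
  exact ⟨h1.1, h1.2.2.trans (foldr_skimStep h1.1)⟩

theorem mem_final_skim_iff [Finite Q] [Finite E] {o : M.LexOrder} {p q : Q} {c : List E} :
    ((q, fun r => trunc k (Nat.card (M.BelowEnd o p c r))) : Q × (Q → Trunc k)) ∈
        (M.skim o k i).final ↔
      q ∈ M.final ∧ trunc k (M.succBelow o p c).ncard = trunc k i := by
  classical
  have : Fintype Q := Fintype.ofFinite Q
  refine and_congr_right fun _ => ?_
  simp only [finsum_eq_sum_of_fintype]
  rw [ncard_succBelow, ← add_zero (∑ r, Nat.card _ * _), ← trunc_sum_trunc, add_zero]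
  simp only [mul_ite, mul_one, mul_zero]

/-- The successful computations of the multi-skimming covering lie over those that have `i` smaller
successful computations. -/
theorem succHists_skim [Finite Q] [Finite E] {o : M.LexOrder} {u : List A}
    {x : (Q × (Q → Trunc k)) × List (M.CovTrans (Q → Trunc k))}
    (hx : x ∈ (M.skim o k i).succHists u) :
    (x.1.1, M.covProj x.2) ∈ M.succHists u ∧
      trunc k (M.succBelow o x.1.1 (M.covProj x.2)).ncard = trunc k i := by
  obtain ⟨⟨⟨q, V⟩, hz, h⟩, hu⟩ := hx
  obtain ⟨h1, h2⟩ := hist_skim h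
  simp only at h2
  rw [h2, mem_final_skim_iff] at hz
  exact ⟨⟨⟨_, hz.1, h1⟩, by rw [← hu, ← (M.isCovering_skim o k i).map_inp]⟩, hz.2⟩

theorem eq_of_trunc_eq {a : ℕ} (hi : i < k) (h : trunc k a = trunc k i) : a = i := by
  rw [trunc_eq_trunc_iff] at h
  omega

theorem unambiguous_skim [Finite Q] [Finite E] (o : M.LexOrder) (hi : i < k) :
    (M.skim o k i).Unambiguous := by
  rw [Unambiguous, isAmbiguousAtMost_iff]
  intro u
  rw [Nat.cast_one, Set.encard_le_one_iff]
  intro x y hx hy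
  obtain ⟨hx1, hx2⟩ := succHists_skim hx
  obtain ⟨hy1, hy2⟩ := succHists_skim hy
  have hlt : ∀ {p q : Q} {c d : List E}, (∃ r ∈ M.final, M.Hist p c r) → o.Below p q c d →
      (M.succBelow o p c).ncard < (M.succBelow o q d).ncard := by
    intro p q c d h1 h2
    refine Set.ncard_lt_ncard ⟨fun b hb => ⟨hb.1, hb.2.trans h2⟩, fun hsub => ?_⟩
      ((finite_setOf_below o q d).subset fun _ h => h.2)
    exact o.below_irrefl p c (hsub (show (p, c) ∈ _ from ⟨h1, h2⟩)).2
  have heq : (M.succBelow o x.1.1 (M.covProj x.2)).ncard =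
      (M.succBelow o y.1.1 (M.covProj y.2)).ncard :=
    (eq_of_trunc_eq hi hx2).trans (eq_of_trunc_eq hi hy2).symm
  obtain ⟨⟨z, -, hz⟩, -⟩ := hx
  obtain ⟨⟨z', -, hz'⟩, -⟩ := hy
  by_cases hne : (x.1.1, M.covProj x.2) = (y.1.1, M.covProj y.2)
  · obtain ⟨h1, h2⟩ := Prod.ext_iff.1 hne
    obtain ⟨h3, h4⟩ := (M.isCovering_skim o k i).injective hz hz' h1 h2
    exact Prod.ext h3 h4
  · obtain ⟨⟨q, hq, hq'⟩, hxu⟩ := hx1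
    obtain ⟨⟨r, hr, hr'⟩, hyu⟩ := hy1
    rcases o.below_total hq' hr' (hxu.trans hyu.symm) hne with h1 | h1
    · exact absurd heq (hlt ⟨q, hq, hq'⟩ h1).ne
    · exact absurd heq (hlt ⟨r, hr, hr'⟩ h1).ne'

/-- If `m` bounds the number of histories with a given input, an accessible vector is determined by
the ends of at most `m` histories. -/
theorem encard_useful_skim_le [Finite Q] [Finite E] (o : M.LexOrder) {m : ℕ}
    (hm : ∀ u, {d : Q × List E | (∃ r, M.Hist d.1 d.2 r) ∧ d.2.map M.inp = u}.encard ≤ m) :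
    {s | (M.skim o k i).Useful s}.encard ≤
      ((Nat.card Q * (Nat.card Q + 1) ^ m : ℕ) : ℕ∞) := by
  have hsub : {s | (M.skim o k i).Useful s} ⊆
      (fun z : Q × (Fin m → Option Q) =>
        ((z.1, fun r => trunc k (Nat.card {j // z.2 j = some r})) : Q × (Q → Trunc k))) ''
        Set.univ := by
    rintro ⟨q, V⟩ ⟨hacc, -⟩
    obtain ⟨s, C, hC⟩ := hacc.exists_hist
    obtain ⟨h1, h2⟩ := hist_skim hC
    simp only at h1 h2
    -- the set of all the smaller histories
    set F : Set (Q × List E) :=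
      {d | (∃ r, M.Hist d.1 d.2 r) ∧ o.Below d.1 s.1 d.2 (M.covProj C)} with hFdef
    have hfin : F.Finite := (finite_setOf_below o s.1 (M.covProj C)).subset fun _ h => h.2
    have : Finite F := hfin
    have hF : Nat.card F ≤ m := by
      have h3 : F.encard ≤ m := by
        refine (Set.encard_le_encard ?_).trans (hm ((M.covProj C).map M.inp))
        exact fun d hd => ⟨hd.1, hd.2.map_inp⟩
      rw [Nat.card_coe_set_eq]
      exact_mod_cast hfin.cast_ncard_eq.trans_le h3
    obtain ⟨f, e, hfe⟩ := exists_enumeration hF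
    choose r hr using fun d : F => d.2.1
    refine ⟨(q, fun j => (f j).map r), trivial, Prod.ext rfl ?_⟩
    rw [h2]
    funext R
    simp only
    congr 1
    refine Nat.card_congr (Equiv.ofBijective (fun d => ⟨e ⟨d.1, ⟨R, d.2.1⟩, d.2.2⟩, by
      rw [(hfe _ _).2 rfl, Option.map_some]
      exact congrArg some ((hr _).end_unique d.2.1)⟩) ⟨?_, ?_⟩).symm
    · intro d d' h
      have h3 : e _ = e _ := congrArg Subtype.val h
      have h4 := (hfe ⟨d.1, ⟨R, d.2.1⟩, d.2.2⟩ _).2 rfl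
      rw [h3, (hfe _ _).2 rfl] at h4
      exact Subtype.ext (congrArg Subtype.val (Option.some_injective _ h4)).symm
    · rintro ⟨j, hj⟩
      obtain ⟨d, hd, rfl⟩ := Option.map_eq_some_iff.1 hj
      exact ⟨⟨d.1, hr d, d.2.2⟩, Subtype.ext ((hfe d j).1 hd)⟩
  refine (Set.encard_le_encard hsub).trans ((Set.encard_image_le _ _).trans ?_)
  rw [Set.encard_univ, ENat.card_eq_coe_natCard, Nat.card_prod, Nat.card_fun,
    Finite.card_option, Nat.card_eq_fintype_card (α := Fin m), Fintype.card_fin]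

end Skim

end Automaton

namespace Transducer

variable {Q : Type u} {A : Type v} {B : Type w} {E : Type x} {T : Transducer Q A B E} {k i : ℕ}

theorem histOut_skim (o : T.LexOrder) (C : List (T.CovTrans (Q → Trunc k))) :
    (T.skim o k i).histOut C = T.histOut (T.covProj C) := by
  simp only [histOut, outWord, Automaton.covProj, ← List.map_reverse, List.map_map]
  rfl

theorem iUnion_rel_skim [Finite Q] [Finite E] (o : T.LexOrder) (hk : T.IsAmbiguousAtMost k) :
    (⋃ i : Fin k, (T.skim o k i).rel) = T.rel := by
  ext ⟨u, w⟩
  simp only [Set.mem_iUnion, mem_rel_iff]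
  constructor
  · rintro ⟨i, s, C, h, rfl⟩
    exact ⟨_, _, (Automaton.succHists_skim h).1, (histOut_skim (i := i) o C).symm⟩
  · rintro ⟨p, c, ⟨⟨q, hq, hc⟩, hu⟩, rfl⟩
    rw [Automaton.isAmbiguousAtMost_iff] at hk
    have hfin := (Automaton.finite_setOf_below o p c)
    have hfin' : (T.succBelow o p c).Finite := hfin.subset fun _ h => h.2
    have hlt : (T.succBelow o p c).ncard < k := by
      have h1 : insert (p, c) (T.succBelow o p c) ⊆ T.succHists u.reverse := by
        rintro d (rfl | hd)
        · exact ⟨⟨q, hq, hc⟩, hu⟩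
        · exact ⟨hd.1, hd.2.map_inp.trans hu⟩
      have h2 := (Set.encard_le_encard h1).trans (hk _)
      rw [Set.encard_insert_of_notMem fun h => o.below_irrefl _ _ h.2,
        ← hfin'.cast_ncard_eq] at h2
      exact_mod_cast h2
    obtain ⟨C, hC, hproj⟩ := (T.toAutomaton.isCovering_skim o k (T.succBelow o p c).ncard).lift hc
    rw [Automaton.foldr_skimStep hc] at hC
    refine ⟨⟨_, hlt⟩, _, C, ⟨⟨_, Automaton.mem_final_skim_iff.2 ⟨hq, rfl⟩, hC⟩, ?_⟩, ?_⟩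
    · rw [← hu, ← hproj]
      exact ((T.toAutomaton.isCovering_skim o k _).map_inp C).symm
    · rw [histOut_skim, hproj]

/-! ### The trim part -/

theorem hist_trimPart {P R : {q : Q // T.Useful q}}
    {C : List {e : E // T.Useful (T.src e) ∧ T.Useful (T.dst e)}} (h : T.trimPart.Hist P C R) :
    T.toAutomaton.Hist P.1 (C.map Subtype.val) R.1 := by
  induction C generalizing R with
  | nil =>
    obtain ⟨h1, rfl⟩ := Automaton.hist_nil.1 h
    exact Automaton.hist_nil.2 ⟨h1, rfl⟩
  | cons e C ih =>
    obtain ⟨rfl, h1⟩ := Automaton.hist_cons.1 h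
    exact Automaton.hist_cons.2 ⟨rfl, ih h1⟩

theorem exists_hist_trimPart {p q : Q} {c : List E} (h : T.toAutomaton.Hist p c q)
    (hq : T.Coaccessible q) :
    ∃ (P R : {q : Q // T.Useful q}) (C : _), P.1 = p ∧ R.1 = q ∧ T.trimPart.Hist P C R ∧
      C.map Subtype.val = c := by
  induction c generalizing q with
  | nil =>
    obtain ⟨h1, rfl⟩ := Automaton.hist_nil.1 h
    exact ⟨⟨p, h.accessible, hq⟩, ⟨p, h.accessible, hq⟩, [], rfl, rfl,
      Automaton.hist_nil.2 ⟨h1, rfl⟩, rfl⟩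
  | cons e c ih =>
    obtain ⟨rfl, h1⟩ := Automaton.hist_cons.1 h
    have hsrc : T.Coaccessible (T.src e) := by
      obtain ⟨t, ht, d, hd⟩ := hq
      exact ⟨t, ht, e :: d, rfl, hd⟩
    obtain ⟨P, R, C, rfl, hR, h2, rfl⟩ := ih h1 hsrc
    refine ⟨P, ⟨T.dst e, h.accessible, hq⟩,
      ⟨e, ⟨h1.accessible, hsrc⟩, ⟨h.accessible, hq⟩⟩ :: C, rfl, rfl,
      Automaton.hist_cons.2 ⟨rfl, ?_⟩, rfl⟩
    obtain rfl : R = ⟨T.src e, h1.accessible, hsrc⟩ := Subtype.ext hR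
    exact h2

theorem map_inp_trimPart (C : List {e : E // T.Useful (T.src e) ∧ T.Useful (T.dst e)}) :
    (C.map Subtype.val).map T.inp = C.map T.trimPart.inp := by
  rw [List.map_map]
  rfl

theorem histOut_trimPart (C : List {e : E // T.Useful (T.src e) ∧ T.Useful (T.dst e)}) :
    T.trimPart.histOut C = T.histOut (C.map Subtype.val) := by
  simp only [histOut, outWord, ← List.map_reverse, List.map_map]
  rfl

theorem trimPart_hist_injective :
    Function.Injective fun c : {q : Q // T.Useful q} ×
      List {e : E // T.Useful (T.src e) ∧ T.Useful (T.dst e)} => (c.1.1, c.2.map Subtype.val) := by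
  rintro ⟨P, C⟩ ⟨P', C'⟩ h
  obtain ⟨h1, h2⟩ := Prod.ext_iff.1 h
  exact Prod.ext (Subtype.ext h1) (List.map_injective_iff.2 Subtype.val_injective h2)

theorem isAmbiguousAtMost_trimPart (h : T.IsAmbiguousAtMost k) :
    T.trimPart.IsAmbiguousAtMost k := by
  rw [Automaton.isAmbiguousAtMost_iff] at h ⊢
  intro u
  rw [← trimPart_hist_injective.encard_image]
  refine (Set.encard_le_encard ?_).trans (h u)
  rintro _ ⟨⟨P, C⟩, ⟨⟨R, hR, hC⟩, hu⟩, rfl⟩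
  exact ⟨⟨R.1, hR, hist_trimPart hC⟩, by rw [map_inp_trimPart, hu]⟩

theorem rel_trimPart : T.trimPart.rel = T.rel := by
  ext ⟨u, w⟩
  simp only [mem_rel_iff]
  constructor
  · rintro ⟨P, C, ⟨⟨R, hR, hC⟩, hu⟩, rfl⟩
    exact ⟨P.1, _, ⟨⟨R.1, hR, hist_trimPart hC⟩, by rw [map_inp_trimPart, hu]⟩,
      (histOut_trimPart C).symm⟩
  · rintro ⟨p, c, ⟨⟨q, hq, hc⟩, hu⟩, rfl⟩
    obtain ⟨P, R, C, rfl, rfl, h1, rfl⟩ := exists_hist_trimPart hc ⟨q, hq, [], rfl⟩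
    exact ⟨P, C, ⟨⟨R, hq, h1⟩, by rw [← map_inp_trimPart, hu]⟩, histOut_trimPart C⟩

end Transducer

/-! ### The decomposition -/

namespace Transducer

variable {Q : Type u} {A : Type v} {B : Type w} {E : Type x} {T : Transducer Q A B E} {k L : ℕ}

/-- At most `k n` histories of the trim part have a given input. -/
theorem encard_hist_core_le [Finite Q] [Finite B] (hT : T.IsTrim) (hk : T.KValued k)
    (hL1 : 1 ≤ L) (hL : ∀ e, (T.out e).length ≤ L) (o : T.LexOrder) (u : List A) :
    {d : _ × List _ | (∃ R, (T.core o k L).Hist d.1 d.2 R) ∧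
      d.2.map (T.core o k L).inp = u}.encard ≤ ((k * Nat.card Q : ℕ) : ℕ∞) := by
  have : Fintype Q := Fintype.ofFinite Q
  rw [← trimPart_hist_injective.encard_image]
  refine (Set.encard_le_encard (t := ⋃ r : Q, {c : _ × List _ | (∃ z, z.1 = r ∧
      (T.lagSelect o (L * Nat.card Q ^ (k + 1))).Hist c.1 c.2 z ∧
      (T.lagSelect o (L * Nat.card Q ^ (k + 1))).Coaccessible z) ∧
      c.2.map (T.lagSelect o (L * Nat.card Q ^ (k + 1))).inp = u}) ?_).trans ?_
  · rintro _ ⟨⟨P, C⟩, ⟨⟨R, hC⟩, hu⟩, rfl⟩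
    exact Set.mem_iUnion.2 ⟨R.1.1, ⟨R.1, rfl, hist_trimPart hC, R.2.2⟩, by
      rw [map_inp_trimPart, hu]⟩
  · refine (Set.encard_iUnion_le_of_fintype _).trans ?_
    refine (Finset.sum_le_sum fun r _ => encard_coaccessible_hist_le hT hk hL1 hL o r u).trans ?_
    rw [Finset.sum_const, Finset.card_univ, ← Nat.card_eq_fintype_card, nsmul_eq_mul, Nat.cast_mul,
      mul_comm]

theorem encard_useful_piece_le [Finite Q] [Finite B] [Finite E] (hT : T.IsTrim)
    (hk : T.KValued k) (hB : 1 ≤ Nat.card B) (hL1 : 1 ≤ L) (hL : ∀ e, (T.out e).length ≤ L)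
    (o : T.LexOrder) (o' : (T.core o k L).LexOrder) (i : ℕ) :
    {s | (T.piece o k L o' i).Useful s}.encard ≤
      ((2 ^ (6 * (Nat.card B * L * k ^ 4 * Nat.card Q ^ (k + 4))) : ℕ) : ℕ∞) := by
  rcases isEmpty_or_nonempty Q with hQ | hQ
  · rw [Set.encard_eq_zero.2 (Set.eq_empty_of_isEmpty _)]
    exact zero_le
  have hk1 := one_le_of_isTrim hT hk
  have hn : 1 ≤ Nat.card Q := Nat.card_pos
  have hX := encard_useful_lagSelect_le_two_pow hT hk o hB (N := L * Nat.card Q ^ (k + 1))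
    (Nat.mul_le_mul hL1 (Nat.one_le_pow _ _ hn)) (by
      -- if the bound on the lags is `1`, there is only one state
      rintro ⟨-, h1, -, h2⟩
      have h3 : Nat.card Q ^ (k + 1) = 1 := Nat.eq_one_of_mul_eq_one_left h1
      rw [Nat.pow_eq_one] at h3
      omega)
  rw [Set.encard, ENat.card_eq_coe_natCard, Nat.cast_le] at hX
  refine (Automaton.encard_useful_skim_le o' (encard_hist_core_le hT hk hL1 hL o)).trans ?_
  rw [Nat.cast_le]
  set n := Nat.card Q
  set h := Nat.card B
  set X := Nat.card {q // (T.lagSelect o (L * n ^ (k + 1))).Useful q}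
  set a := h * L * k ^ 2 * n ^ (k + 2) with ha
  have ha1 : 1 ≤ a := Nat.mul_le_mul (Nat.mul_le_mul (Nat.mul_le_mul hB hL1)
    (Nat.one_le_pow _ _ hk1)) (Nat.one_le_pow _ _ hn)
  have hkn : 1 ≤ k * n := Nat.mul_le_mul hk1 hn
  have hX' : X + 1 ≤ 2 ^ (3 * a) := by
    have h1 : 2 * h * (L * n ^ (k + 1)) * k ^ 2 * n = 2 * a := by rw [ha]; ring
    have hX2 : X ≤ 2 ^ (2 * a) := h1 ▸ hX
    have h2 : 2 ^ (2 * a) + 1 ≤ 2 ^ (2 * a + 1) := by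
      rw [pow_succ]
      have := Nat.one_le_two_pow (n := 2 * a)
      omega
    exact (Nat.succ_le_succ hX2).trans (h2.trans (Nat.pow_le_pow_right (by norm_num) (by omega)))
  calc X * (X + 1) ^ (k * n) ≤ (X + 1) * (X + 1) ^ (k * n) :=
        Nat.mul_le_mul_right _ (Nat.le_succ X)
    _ = (X + 1) ^ (k * n + 1) := (pow_succ' _ _).symm
    _ ≤ (2 ^ (3 * a)) ^ (k * n + 1) := Nat.pow_le_pow_left hX' _
    _ = 2 ^ (3 * a * (k * n + 1)) := (pow_mul _ _ _).symm
    _ ≤ 2 ^ (6 * (h * L * k ^ 4 * n ^ (k + 4))) := by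
        refine Nat.pow_le_pow_right (by norm_num) ?_
        calc 3 * a * (k * n + 1) ≤ 3 * a * (2 * (k * n) * (k * n)) := by
              refine Nat.mul_le_mul_left _ ?_
              nlinarith
          _ = 6 * (h * L * k ^ 4 * n ^ (k + 4)) := by rw [ha]; ring

end Transducer

end RatRel

theorem mainTheorem6 :
    ∃ C : ℕ, ∀ {Q A B E : Type*} [Finite Q] [Finite B] [Finite E]
      (T : RatRel.Transducer Q A B E) (o : T.LexOrder) (k : ℕ),
      T.IsTrim → T.KValued k → 1 ≤ Nat.card B →
      (∀ N : ℕ, 1 ≤ N → ¬ (Nat.card B = 1 ∧ N = 1 ∧ k = 1 ∧ 5 ≤ Nat.card Q) →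
        {s | (T.lagSelect o N).Useful s}.encard
          ≤ ((2 ^ (2 * Nat.card B * N * k ^ 2 * Nat.card Q) : ℕ) : ℕ∞)) ∧
      (∀ L : ℕ, 1 ≤ L → (∀ e, (T.out e).length ≤ L) →
        (T.lagSelect o (L * Nat.card Q ^ (k + 1))).IsAmbiguousAtMost k ∧
        ∀ o' : (T.core o k L).LexOrder,
          (⋃ i : Fin k, (T.piece o k L o' i).rel) = T.rel ∧
          ∀ i : Fin k,
            (T.piece o k L o' i).Unambiguous ∧
            {s | (T.piece o k L o' i).Useful s}.encard
              ≤ ((2 ^ (C * (Nat.card B * L * k ^ 4 * Nat.card Q ^ (k + 4))) : ℕ) : ℕ∞)) := by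
  refine ⟨6, fun T o k hT hk hB => ⟨fun N hN hex =>
    RatRel.Transducer.encard_useful_lagSelect_le_two_pow hT hk o hB hN hex, fun L hL1 hL => ?_⟩⟩
  have hamb := RatRel.Transducer.isAmbiguousAtMost_lagSelect hk hL1 hL o
  refine ⟨hamb, fun o' => ⟨?_, fun i => ⟨RatRel.Automaton.unambiguous_skim o' i.2,
    RatRel.Transducer.encard_useful_piece_le hT hk hB hL1 hL o o' i⟩⟩⟩
  exact (RatRel.Transducer.iUnion_rel_skim o'
    (RatRel.Transducer.isAmbiguousAtMost_trimPart hamb)).trans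
    (RatRel.Transducer.rel_trimPart.trans (RatRel.Transducer.rel_lagSelect o _))
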